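/- Let $\ell>0$, $I=[0,\ell]$, $\alpha\in[0,\pi)$, $\beta\in(0,\pi]$. For $q\in L^1(I,\mathbb R)$ consider the Sturm–Liouville problem $-z''+q(x)z=\lambda z$ on $I$ with boundary conditions $z(0)\cos\alpha-z'(0)\sin\alpha=0$ and $z(\ell)\cos\beta-z'(\ell)\sin\beta=0$. (Solutions of linear second-order equations with integrable coefficients are understood in the Carathéodory sense: $z$ is differentiable on $I$, $z'$ is absolutely continuous, and the equation holds almost everywhere.) For $n=0,1,2,\dots$ let $\lambda_n(q)$ be the $n$-th eigenvalue in increasing order, i.e. the eigenvalue with exactly $n$ eigenvalues strictly below it. Theorem. Let $q,h\in L^1(I,\mathbb R)$ and $n\ge 0$. The eigenvalue $\lambda_n(q)$ exists, and the functional $\lambda_n:L^1(I,\mathbb R)\to\mathbb R$ is of class $C^2$ in the Fréchet sense near $q$. There is exactly one function $E_n$ on $I$ which solves the boundary value problem with $\lambda=\lambda_n(q)$, satisfies $\left(\int_I E_n^2\,dx\right)^{1/2}=1$, and is positive on some interval $(0,\delta)$. The first derivative of $\lambda_n$ at $q$ in the direction $h$ is $$L:=\partial_q\lambda_n(q)(h)=\frac{d}{ds}\lambda_n(q+sh)\Big|_{s=0}=\int_I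 E_n(x)^2h(x)\,dx .$$ Let $\psi_1,\psi_2$ be the unique solutions of $-z''+(q-\lambda_n(q))z=0$ on $I$ with $(z(0),z'(0))=(1,0)$ and $(0,1)$ respectively, and let $W(x,y)=\psi_1(x)\psi_2(y)-\psi_2(x)\psi_1(y)$. The initial value problem $$-z''+(q(x)-\lambda_n(q))z=-E_n(x)(h(x)-L),\qquad z(0)=z'(0)=0,$$ has a unique solution $U_n$ on $I$, and $$U_n(x)=\int_0^x W(x,y)E_n(y)(L-h(y))\,dy,\qquad x\in I.$$ The second-order Fréchet derivative $\partial_{qq}\lambda_n(q)(h):=\frac{d^2}{ds^2}\lambda_n(q+sh)\big|_{s=0}$, which equals $D^2\lambda_n(q)[h,h]$, is given by $$\partial_{qq}\lambda_n(q)(h)=2\int_I E_n(x)(h(x)-L)U_n(x)\,dx .$$ Moreover, it is a quadratic form of $h$, $$\partial_{qq}\lambda_n(q)(h)=\int_{I^2}J_n(x,y)h(x)h(y)\,dx\,dy,$$ where, with $G(x,y)=W(x,y)$ for $x\le y$ and $G(x,y)=-W(x,y)$ for $y\le x$, $$J_n(x,y)=\left(\int_{I^2}J_n(x,y,u,v)E_n(u)E_n(v)\,du\,dv\right)E_n(x)E_n(y),$$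 $$J_n(x,y,u,v)=G(x,y)E_n(u)E_n(v)-G(x,v)E_n(u)E_n(y)-G(u,y)E_n(x)E_n(v)+G(u,v)E_n(x)E_n(y).$$ All these integrals converge absolutely. -/

import Mathlib

open Set MeasureTheory

noncomputable section

namespace SturmLiouville

/-- Lebesgue measure on the closed interval `I = [0, ℓ]`. -/
abbrev μI (ℓ : ℝ) : Measure ℝ := volume.restrict (Icc 0 ℓ)

/-- The Banach space `L¹(I, ℝ)` of potentials, with its `L¹` norm. -/
abbrev Potential (ℓ : ℝ) : Type := Lp ℝ 1 (μI ℓ)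

/-- The derivative `z'` of a function on `I` (one-sided at the two end-points). -/
def dI (ℓ : ℝ) (z : ℝ → ℝ) : ℝ → ℝ := derivWithin z (Icc 0 ℓ)

/-- `z` is a (Carathéodory) solution on `I` of `-z'' + Q(x) z = f(x)`: `z` is differentiable on `I`,
its derivative is absolutely continuous on `I`, and the equation, in the form `z'' = Q z - f`,
holds almost everywhere on `I`. -/
structure IsSolution (ℓ : ℝ) (Q f z : ℝ → ℝ) : Prop where
  differentiableOn : DifferentiableOn ℝ z (Icc 0 ℓ)
  absolutelyContinuous : AbsolutelyContinuousOnInterval (dI ℓ z) 0 ℓ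
  equation : ∀ᵐ x ∂(μI ℓ), HasDerivAt (dI ℓ z) (Q x * z x - f x) x

/-- `z` solves `-z'' + Q z = f` on `I` with initial conditions `z(0) = a`, `z'(0) = b`. -/
def IsIVPSolution (ℓ : ℝ) (Q f : ℝ → ℝ) (a b : ℝ) (z : ℝ → ℝ) : Prop :=
  IsSolution ℓ Q f z ∧ z 0 = a ∧ dI ℓ z 0 = b

/-- `z` solves `-z'' + q z = lam z` on `I` and satisfies both separated boundary conditions. -/
def SolvesBVP (ℓ α β : ℝ) (q : Potential ℓ) (lam : ℝ) (z : ℝ → ℝ) : Prop :=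
  IsSolution ℓ (fun x => q x - lam) (fun _ => 0) z ∧
    z 0 * Real.cos α - dI ℓ z 0 * Real.sin α = 0 ∧
    z ℓ * Real.cos β - dI ℓ z ℓ * Real.sin β = 0

/-- The set of eigenvalues of the boundary value problem. -/
def eigenvalues (ℓ α β : ℝ) (q : Potential ℓ) : Set ℝ :=
  {lam | ∃ z : ℝ → ℝ, SolvesBVP ℓ α β q lam z ∧ ∃ x ∈ Icc 0 ℓ, z x ≠ 0}

/-- `lam` is the `n`-th eigenvalue (`n = 0, 1, 2, …`, in increasing order): it is an eigenvalue and
exactly `n` eigenvalues lie strictly below it. -/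
def IsNthEigenvalue (ℓ α β : ℝ) (n : ℕ) (q : Potential ℓ) (lam : ℝ) : Prop :=
  lam ∈ eigenvalues ℓ α β q ∧ (eigenvalues ℓ α β q ∩ Iio lam).encard = n

open Classical in
/-- The `n`-th eigenvalue as a functional of the potential. (The value `0` is used if there is no
such eigenvalue.) -/
def eigenvalue (ℓ α β : ℝ) (n : ℕ) (q : Potential ℓ) : ℝ :=
  if hex : ∃ lam, IsNthEigenvalue ℓ α β n q lam then hex.choose else 0

/-- `E` is the normalized eigenfunction for the eigenvalue `lam`: it solves the boundary value
problem, has `L²(I)` norm one, and is positive on some interval `(0, δ)`. -/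
def IsNormalizedEigenfunction (ℓ α β : ℝ) (q : Potential ℓ) (lam : ℝ) (E : ℝ → ℝ) : Prop :=
  SolvesBVP ℓ α β q lam E ∧
    Real.sqrt (∫ x, E x ^ 2 ∂(μI ℓ)) = 1 ∧
    ∃ δ > 0, ∀ x ∈ Ioo 0 δ, 0 < E x

/-- As a function on `I`, `z` is the only one with the property `P`. -/
def IsUniqueOn (ℓ : ℝ) (P : (ℝ → ℝ) → Prop) (z : ℝ → ℝ) : Prop :=
  P z ∧ ∀ w, P w → EqOn w z (Icc 0 ℓ)

/-- `W(x,y) = ψ₁(x) ψ₂(y) - ψ₂(x) ψ₁(y)`. -/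
def kernelW (ψ₁ ψ₂ : ℝ → ℝ) (x y : ℝ) : ℝ := ψ₁ x * ψ₂ y - ψ₂ x * ψ₁ y

/-- `G(x,y) = W(x,y)` for `x ≤ y` and `G(x,y) = -W(x,y)` for `y ≤ x`. -/
def kernelG (ψ₁ ψ₂ : ℝ → ℝ) (x y : ℝ) : ℝ :=
  if x ≤ y then kernelW ψ₁ ψ₂ x y else -kernelW ψ₁ ψ₂ x y

/-- The kernel `J(x,y,u,v)` on `I⁴`. -/
def kernelJ4 (ψ₁ ψ₂ E : ℝ → ℝ) (x y u v : ℝ) : ℝ :=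
  kernelG ψ₁ ψ₂ x y * E u * E v - kernelG ψ₁ ψ₂ x v * E u * E y
    - kernelG ψ₁ ψ₂ u y * E x * E v + kernelG ψ₁ ψ₂ u v * E x * E y

/-- The kernel `J(x,y) = (∫_{I²} J(x,y,u,v) E(u) E(v) du dv) E(x) E(y)` on `I²`. -/
def kernelJ (ℓ : ℝ) (ψ₁ ψ₂ E : ℝ → ℝ) (x y : ℝ) : ℝ :=
  (∫ p : ℝ × ℝ, kernelJ4 ψ₁ ψ₂ E x y p.1 p.2 * E p.1 * E p.2 ∂((μI ℓ).prod (μI ℓ))) * E x * E y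

/-- The second derivative of a functional in the direction `h`: `∂²/∂s² F(q + s h)` at `s = 0`. -/
def secondDeriv {ℓ : ℝ} (F : Potential ℓ → ℝ) (q h : Potential ℓ) : ℝ :=
  iteratedDeriv 2 (fun s : ℝ => F (q + s • h)) 0

end SturmLiouville

end

/-!
The boundary value problem is solved by shooting. The equation `z'' = Q z` with initial data
`(a, b)` is the integral equation `z = a + b x + ∫∫ Q z`, whose operator `picard` has powers of
norm at most `(‖Q‖ ℓ) ^ n / n!`. Hence `1 - picard` is invertible, and since it is affine in the
potential, the solution `solZ` is a smooth function of `Q ∈ L¹` with values in the continuous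
functions. Let `z` have initial data `(sin α, cos α)`. A number `λ` is an eigenvalue for `q` if
and only if `bdry = z(ℓ) cos β - z'(ℓ) sin β` vanishes at the potential `Q = q - λ`
(`mem_eigenvalues_iff`). The Lagrange identity between `z` and its variation shows that at a zero
the derivative of `bdry` in the direction `H` is a nonzero multiple of `∫ H z²`
(`fderiv_bdry_of_eq_zero`); in particular it does not vanish for `H = 1`, which is the
nondegeneracy needed for the implicit function theorem.

Numbering of the eigenvalues rests on the Prüfer angle `Θ` at `ℓ`, defined by
`(z', z) = r (cos Θ, sin Θ)` and continued from the value `α` at `0`. Since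
`bdry = r sin (Θ - β)`, the eigenvalues are the solutions of `Θ(q - λ) = β + k π` with an integer
`k`. The angle depends continuously on the potential in `L¹`, and is strictly increasing in `λ`
because of the sign of the derivative of the boundary function with any angle `γ` in place of `β`.
It is positive, falls below `β` as `λ → -∞`, and is unbounded as `λ → ∞`. So `λ_n` exists and is
the solution of `Θ(q - λ) = β + n π` (`isNthEigenvalue_iff`), monotonicity in `λ` makes it
continuous in `q`, and a continuous zero of `bdry` is the implicit function, hence of class `C²`
(`contDiffAt_eigenvalue`).

Differentiating `bdry (q - λ_n(q)) = 0` gives `∂λ_n(h) = ∫ h z² / ∫ z²`. Differentiating this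
quotient along `q + s h` gives `2 ∫ (h - L) z ż / ∫ z²`, where `ż` is the variation of `z` along
`h - L` (`secondDeriv_eigenvalue`). After normalization `ż` becomes `U_n`, since both solve the
same inhomogeneous initial value problem, and variation of constants writes `U_n` through the
kernel `W`. The resulting integral over the triangle `y ≤ x` is half of the integral over the
square against the symmetric kernel `G` (`integral_kernelG_mul_self`), and expanding
`h - L = h - ∫ E_n² h` turns that integral into the quadratic form with kernel `J_n`
(`integral_kernelJ`).
-/

noncomputable section

namespace SturmLiouville

open Filter Topology
open scoped BoundedContinuousFunction ContDiff

variable {ℓ : ℝ}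

/-! ### Absolutely continuous functions with a prescribed almost-everywhere derivative -/

/-- `f` is absolutely continuous on `[0, ℓ]` and `f'` is its derivative almost everywhere there.
The derivative is part of the data, so that an equation between derivatives which holds only
almost everywhere need not be phrased through `deriv`. -/
structure HasACDeriv (ℓ : ℝ) (f f' : ℝ → ℝ) : Prop where
  ac : AbsolutelyContinuousOnInterval f 0 ℓ
  deriv : ∀ᵐ x ∂(μI ℓ), HasDerivAt f (f' x) x

lemma ae_muI_iff {p : ℝ → Prop} : (∀ᵐ x ∂(μI ℓ), p x) ↔ ∀ᵐ x, x ∈ Icc 0 ℓ → p x :=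
  ae_restrict_iff' measurableSet_Icc

lemma ae_muI_mem_Ioo : ∀ᵐ x ∂(μI ℓ), x ∈ Ioo 0 ℓ := by
  rw [ae_muI_iff]
  have h0 : ∀ᵐ x : ℝ, x ≠ 0 := by simp [ae_iff, measure_singleton]
  have h1 : ∀ᵐ x : ℝ, x ≠ ℓ := by simp [ae_iff, measure_singleton]
  filter_upwards [h0, h1] with x h0 h1 hx
  exact ⟨lt_of_le_of_ne hx.1 (Ne.symm h0), lt_of_le_of_ne hx.2 h1⟩

lemma ac_congr {f g : ℝ → ℝ} (hf : AbsolutelyContinuousOnInterval f 0 ℓ)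
    (hfg : EqOn f g (uIcc 0 ℓ)) : AbsolutelyContinuousOnInterval g 0 ℓ := by
  refine Tendsto.congr' ?_ hf
  filter_upwards [mem_inf_of_right (mem_principal_self _)] with E hE
  refine Finset.sum_congr rfl fun i hi => ?_
  rw [hfg (hE.1 i hi).1, hfg (hE.1 i hi).2]

lemma ac_comp_of_lipschitzOnWith {f g : ℝ → ℝ} {K : NNReal} {s : Set ℝ}
    (hf : AbsolutelyContinuousOnInterval f 0 ℓ) (hg : LipschitzOnWith K g s)
    (hs : MapsTo f (uIcc 0 ℓ) s) : AbsolutelyContinuousOnInterval (fun x => g (f x)) 0 ℓ := by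
  have hlim := (Tendsto.const_mul (K : ℝ) hf)
  rw [mul_zero] at hlim
  refine squeeze_zero' (Eventually.of_forall fun E => Finset.sum_nonneg fun i _ => dist_nonneg) ?_ hlim
  filter_upwards [mem_inf_of_right (mem_principal_self _)] with E hE
  rw [Finset.mul_sum]
  refine Finset.sum_le_sum fun i hi => ?_
  exact hg.dist_le_mul _ (hs (hE.1 i hi).1) _ (hs (hE.1 i hi).2)

namespace HasACDeriv

variable {f f' g g' : ℝ → ℝ}

lemma congr_deriv (hf : HasACDeriv ℓ f f') (h : f' =ᵐ[μI ℓ] g') : HasACDeriv ℓ f g' :=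
  ⟨hf.ac, by filter_upwards [hf.deriv, h] with x hx h; rwa [← h]⟩

lemma congr (hf : HasACDeriv ℓ f f') (h : EqOn f g (Icc 0 ℓ)) (hℓ : 0 ≤ ℓ) :
    HasACDeriv ℓ g f' := by
  refine ⟨ac_congr hf.ac (by rwa [uIcc_of_le hℓ]), ?_⟩
  filter_upwards [hf.deriv, ae_muI_mem_Ioo] with x hx hmem
  refine hx.congr_of_eventuallyEq ?_
  filter_upwards [Ioo_mem_nhds hmem.1 hmem.2] with y hy
  exact (h ⟨hy.1.le, hy.2.le⟩).symm

lemma const (c : ℝ) : HasACDeriv ℓ (fun _ => c) (fun _ => 0) :=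
  ⟨(LipschitzWith.const c).lipschitzOnWith.absolutelyContinuousOnInterval,
    Eventually.of_forall fun x => hasDerivAt_const x c⟩

lemma add (hf : HasACDeriv ℓ f f') (hg : HasACDeriv ℓ g g') :
    HasACDeriv ℓ (fun x => f x + g x) (fun x => f' x + g' x) :=
  ⟨hf.ac.fun_add hg.ac, by filter_upwards [hf.deriv, hg.deriv] with x h1 h2 using h1.add h2⟩

lemma sub (hf : HasACDeriv ℓ f f') (hg : HasACDeriv ℓ g g') :
    HasACDeriv ℓ (fun x => f x - g x) (fun x => f' x - g' x) :=
  ⟨hf.ac.fun_sub hg.ac, by filter_upwards [hf.deriv, hg.deriv] with x h1 h2 using h1.sub h2⟩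

lemma mul (hf : HasACDeriv ℓ f f') (hg : HasACDeriv ℓ g g') :
    HasACDeriv ℓ (fun x => f x * g x) (fun x => f' x * g x + f x * g' x) :=
  ⟨hf.ac.fun_mul hg.ac, by filter_upwards [hf.deriv, hg.deriv] with x h1 h2 using h1.mul h2⟩

lemma const_mul (c : ℝ) (hf : HasACDeriv ℓ f f') :
    HasACDeriv ℓ (fun x => c * f x) (fun x => c * f' x) :=
  ⟨hf.ac.const_mul c, by filter_upwards [hf.deriv] with x h1 using h1.const_mul c⟩

/-- Chain rule for an outer function which is differentiable and Lipschitz on the range. -/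
lemma comp {φ φ' : ℝ → ℝ} {K : NNReal} {s : Set ℝ} (hf : HasACDeriv ℓ f f')
    (hφ : LipschitzOnWith K φ s) (hs : MapsTo f (uIcc 0 ℓ) s)
    (hd : ∀ y ∈ s, HasDerivAt φ (φ' y) y) :
    HasACDeriv ℓ (fun x => φ (f x)) (fun x => φ' (f x) * f' x) := by
  refine ⟨ac_comp_of_lipschitzOnWith hf.ac hφ hs, ?_⟩
  filter_upwards [hf.deriv, ae_muI_mem_Ioo] with x h1 hx
  refine (hd _ (hs ?_)).comp x h1
  exact Icc_subset_uIcc ⟨hx.1.le, hx.2.le⟩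

lemma sin (hf : HasACDeriv ℓ f f') :
    HasACDeriv ℓ (fun x => Real.sin (f x)) (fun x => Real.cos (f x) * f' x) := by
  refine hf.comp (K := 1) (s := univ) ?_ (mapsTo_univ _ _) fun y _ => Real.hasDerivAt_sin y
  refine LipschitzWith.lipschitzOnWith (lipschitzWith_of_nnnorm_deriv_le Real.differentiable_sin ?_)
  intro x
  rw [Real.deriv_sin, ← NNReal.coe_le_coe]
  simpa using Real.abs_cos_le_one x

lemma cos (hf : HasACDeriv ℓ f f') :
    HasACDeriv ℓ (fun x => Real.cos (f x)) (fun x => -Real.sin (f x) * f' x) := by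
  refine hf.comp (K := 1) (s := univ) ?_ (mapsTo_univ _ _) fun y _ => Real.hasDerivAt_cos y
  refine LipschitzWith.lipschitzOnWith (lipschitzWith_of_nnnorm_deriv_le Real.differentiable_cos ?_)
  intro x
  rw [Real.deriv_cos, ← NNReal.coe_le_coe]
  simpa using Real.abs_sin_le_one x

lemma continuousOn (hf : HasACDeriv ℓ f f') : ContinuousOn f (Icc 0 ℓ) :=
  hf.ac.continuousOn.mono Icc_subset_uIcc

/-- Chain rule for a continuously differentiable outer function, on the
range of the inner one. -/
lemma comp_contDiffOn {φ φ' : ℝ → ℝ} (hf : HasACDeriv ℓ f f') {s : Set ℝ}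
    (hs : MapsTo f (uIcc 0 ℓ) s) (hφ : ContDiffOn ℝ 1 φ s)
    (hd : ∀ y ∈ s, HasDerivAt φ (φ' y) y) :
    HasACDeriv ℓ (fun x => φ (f x)) (fun x => φ' (f x) * f' x) := by
  have hK : f '' uIcc 0 ℓ = Icc (sInf (f '' uIcc 0 ℓ)) (sSup (f '' uIcc 0 ℓ)) :=
    eq_Icc_of_connected_compact
      (IsConnected.image ⟨nonempty_uIcc, isPreconnected_uIcc⟩ _ hf.ac.continuousOn)
      (isCompact_uIcc.image_of_continuousOn hf.ac.continuousOn)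
  obtain ⟨K, hKL⟩ := (hφ.mono hs.image_subset).exists_lipschitzOnWith (by decide)
    (hK ▸ convex_Icc _ _) (isCompact_uIcc.image_of_continuousOn hf.ac.continuousOn)
  exact hf.comp hKL (mapsTo_image _ _) fun y hy => hd y (hs.image_subset hy)

lemma exp (hf : HasACDeriv ℓ f f') :
    HasACDeriv ℓ (fun x => Real.exp (f x)) (fun x => Real.exp (f x) * f' x) :=
  hf.comp_contDiffOn (mapsTo_univ _ _) Real.contDiff_exp.contDiffOn
    fun y _ => Real.hasDerivAt_exp y

lemma inv (hf : HasACDeriv ℓ f f') (hpos : ∀ x ∈ uIcc 0 ℓ, 0 < f x) :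
    HasACDeriv ℓ (fun x => (f x)⁻¹) (fun x => -(f x ^ 2)⁻¹ * f' x) :=
  hf.comp_contDiffOn (φ := fun y => y⁻¹) (φ' := fun y => -(y ^ 2)⁻¹) hpos
    (contDiffOn_id.inv fun _ hy => ne_of_gt hy) fun _ hy => hasDerivAt_inv (ne_of_gt hy)

lemma ae_eq_deriv (hf : HasACDeriv ℓ f f') : _root_.deriv f =ᵐ[μI ℓ] f' := by
  filter_upwards [hf.deriv] with x hx using hx.deriv

lemma integrable (hf : HasACDeriv ℓ f f') (hℓ : 0 ≤ ℓ) : Integrable f' (μI ℓ) := by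
  have h := hf.ac.intervalIntegrable_deriv
  rw [intervalIntegrable_iff_integrableOn_Icc_of_le hℓ] at h
  exact Integrable.congr h hf.ae_eq_deriv

lemma integral_eq_sub (hf : HasACDeriv ℓ f f') {a b : ℝ} (ha : 0 ≤ a) (hab : a ≤ b) (hb : b ≤ ℓ) :
    ∫ t in a..b, f' t = f b - f a := by
  have hm : AbsolutelyContinuousOnInterval f a b := hf.ac.mono (by
    rw [uIcc_of_le hab, uIcc_of_le (ha.trans (hab.trans hb))]; exact Icc_subset_Icc ha hb)
  rw [← hm.integral_deriv_eq_sub]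
  refine intervalIntegral.integral_congr_ae ?_
  have := ae_muI_iff.1 hf.ae_eq_deriv
  filter_upwards [this] with x hx hmem
  rw [uIoc_of_le hab] at hmem
  exact (hx ⟨ha.trans hmem.1.le, hmem.2.trans hb⟩).symm

lemma monotoneOn (hf : HasACDeriv ℓ f f') {b : ℝ} (hb : b ≤ ℓ)
    (h : ∀ᵐ x ∂(μI ℓ), x < b → 0 ≤ f' x) : ∀ x ∈ Icc 0 b, f 0 ≤ f x := by
  intro x hx
  have := hf.integral_eq_sub le_rfl hx.1 (hx.2.trans hb)
  have h0 : 0 ≤ ∫ t in (0 : ℝ)..x, f' t := by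
    refine intervalIntegral.integral_nonneg_of_ae_restrict hx.1 ?_
    rw [EventuallyLE, ae_restrict_iff' measurableSet_Icc]
    have hb' : ∀ᵐ x : ℝ, x ≠ b := by simp [ae_iff, measure_singleton]
    filter_upwards [ae_muI_iff.1 h, hb'] with t ht htb hmem
    exact ht ⟨hmem.1, hmem.2.trans (hx.2.trans hb)⟩ (lt_of_le_of_ne (hmem.2.trans hx.2) htb)
  linarith

lemma eq_of_deriv_zero (hf : HasACDeriv ℓ f f') (h : f' =ᵐ[μI ℓ] fun _ => 0) {x : ℝ}
    (hx : x ∈ Icc 0 ℓ) : f x = f 0 := by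
  have h1 := (hf.congr_deriv h).integral_eq_sub le_rfl hx.1 hx.2
  simp at h1
  linarith

end HasACDeriv

lemma intervalIntegrable_of_integrable {g : ℝ → ℝ} (hg : Integrable g (μI ℓ)) {a b : ℝ}
    (ha : a ∈ Icc 0 ℓ) (hb : b ∈ Icc 0 ℓ) : IntervalIntegrable g volume a b := by
  have : IntegrableOn g (uIcc a b) := IntegrableOn.mono_set hg (uIcc_subset_Icc ha hb)
  exact this.intervalIntegrable

lemma hasACDeriv_integral {g : ℝ → ℝ} (hℓ : 0 ≤ ℓ) (hg : Integrable g (μI ℓ)) (c : ℝ) :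
    HasACDeriv ℓ (fun x => c + ∫ t in (0 : ℝ)..x, g t) g := by
  have hi : IntervalIntegrable g volume 0 ℓ :=
    intervalIntegrable_of_integrable hg (left_mem_Icc.2 hℓ) (right_mem_Icc.2 hℓ)
  have h : HasACDeriv ℓ (fun x => ∫ t in (0 : ℝ)..x, g t) g := by
    refine ⟨hi.absolutelyContinuousOnInterval_intervalIntegral (by simp), ?_⟩
    rw [ae_muI_iff]
    filter_upwards [hi.ae_hasDerivAt_integral] with x hx hmem
    exact hx (Icc_subset_uIcc hmem) 0 (by simp)
  exact ((HasACDeriv.const c).add h).congr_deriv (by simp)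

/-- A function that agrees on `[0, ℓ]` with a primitive of an integrable function. -/
lemma hasACDeriv_of_eq_integral {f g : ℝ → ℝ} (hℓ : 0 ≤ ℓ) (hg : Integrable g (μI ℓ)) {c : ℝ}
    (h : ∀ x ∈ Icc 0 ℓ, f x = c + ∫ t in (0 : ℝ)..x, g t) : HasACDeriv ℓ f g :=
  (hasACDeriv_integral hℓ hg c).congr (fun x hx => (h x hx).symm) hℓ

/-! ### The Volterra operator and the solution map -/

lemma integrable_mul_bcf {g : ℝ → ℝ} (hg : Integrable g (μI ℓ)) (z : ℝ →ᵇ ℝ) :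
    Integrable (fun t => g t * z t) (μI ℓ) := by
  refine hg.mul_bdd (c := ‖z‖) z.continuous.aestronglyMeasurable ?_
  exact Eventually.of_forall fun t => z.norm_coe_le_norm t

lemma integrable_potential (Q : Potential ℓ) : Integrable (fun t => Q t) (μI ℓ) :=
  L1.integrable_coeFn Q

lemma continuous_setIntegral_Iic {g : ℝ → ℝ} (hg : Integrable g (μI ℓ)) :
    Continuous fun x => ∫ t in Iic x, g t ∂(μI ℓ) := by
  have h : (fun x => ∫ t in Iic x, g t ∂(μI ℓ)) =
      fun x => (∫ t in Iic (0 : ℝ), g t ∂(μI ℓ)) + ∫ t in (0 : ℝ)..x, g t ∂(μI ℓ) := by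
    funext x
    rw [← intervalIntegral.integral_Iic_sub_Iic hg.integrableOn hg.integrableOn]
    ring
  rw [h]
  exact continuous_const.add
    (intervalIntegral.continuous_primitive (fun a b => hg.intervalIntegrable) 0)

lemma setIntegral_Iic_eq {g : ℝ → ℝ} {x : ℝ} (hx : x ∈ Icc 0 ℓ) :
    ∫ t in Iic x, g t ∂(μI ℓ) = ∫ t in (0 : ℝ)..x, g t := by
  rw [intervalIntegral.integral_of_le hx.1, ← integral_Icc_eq_integral_Ioc,
    Measure.restrict_restrict measurableSet_Iic]
  congr 2
  ext t
  exact ⟨fun h => ⟨h.2.1, h.1⟩, fun h => ⟨h.2, h.1, h.2.trans hx.2⟩⟩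

lemma setIntegral_Iic_of_neg {g : ℝ → ℝ} {x : ℝ} (hx : x < 0) :
    ∫ t in Iic x, g t ∂(μI ℓ) = 0 := by
  rw [Measure.restrict_restrict measurableSet_Iic]
  have : Iic x ∩ Icc 0 ℓ = ∅ := by
    ext t; simp only [mem_inter_iff, mem_Iic, mem_Icc, mem_empty_iff_false, iff_false]
    intro h; linarith [h.1, h.2.1]
  simp [this]

lemma setIntegral_Iic_of_ge {g : ℝ → ℝ} {x : ℝ} (hx : ℓ ≤ x) :
    ∫ t in Iic x, g t ∂(μI ℓ) = ∫ t, g t ∂(μI ℓ) := by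
  rw [Measure.restrict_restrict measurableSet_Iic]
  congr 2
  ext t
  exact ⟨fun h => h.2, fun h => ⟨h.2.trans hx, h⟩⟩

lemma norm_potential (Q : Potential ℓ) : ‖Q‖ = ∫ t, |Q t| ∂(μI ℓ) :=
  L1.norm_eq_integral_norm Q

lemma abs_setIntegral_mul_le (Q : Potential ℓ) (z : ℝ →ᵇ ℝ) {x B : ℝ}
    (hB : ∀ t ∈ Icc 0 ℓ, t ≤ x → |z t| ≤ B) (hB0 : 0 ≤ B) :
    |∫ t in Iic x, Q t * z t ∂(μI ℓ)| ≤ ‖Q‖ * B := by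
  have hQ := integrable_potential Q
  calc |∫ t in Iic x, Q t * z t ∂(μI ℓ)| ≤ ∫ t in Iic x, |Q t| * B ∂(μI ℓ) := by
        rw [← Real.norm_eq_abs]
        refine norm_integral_le_of_norm_le (hQ.abs.mul_const B).integrableOn ?_
        rw [ae_restrict_iff' measurableSet_Iic, ae_muI_iff]
        refine Eventually.of_forall fun t ht htx => ?_
        rw [Real.norm_eq_abs, abs_mul]
        exact mul_le_mul_of_nonneg_left (hB t ht htx) (abs_nonneg _)
    _ ≤ ∫ t, |Q t| * B ∂(μI ℓ) := by
        refine setIntegral_le_integral (hQ.abs.mul_const B) ?_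
        exact Eventually.of_forall fun t => mul_nonneg (abs_nonneg _) hB0
    _ = ‖Q‖ * B := by rw [integral_mul_const, norm_potential]

/-- The operator `(Q, z) ↦ (x ↦ ∫₀ˣ Q z)` as a bounded bilinear map. Functions on `[0, ℓ]` are
represented by bounded continuous functions on the line, primitives being continued by constants
outside `[0, ℓ]`. -/
def volterra (ℓ : ℝ) : Potential ℓ →L[ℝ] (ℝ →ᵇ ℝ) →L[ℝ] (ℝ →ᵇ ℝ) :=
  LinearMap.mkContinuous₂
    (LinearMap.mk₂ ℝ
      (fun (Q : Potential ℓ) (z : ℝ →ᵇ ℝ) =>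
        BoundedContinuousFunction.ofNormedAddCommGroup
          (fun x => ∫ t in Iic x, Q t * z t ∂(μI ℓ))
          (continuous_setIntegral_Iic (integrable_mul_bcf (integrable_potential Q) z))
          (‖Q‖ * ‖z‖)
          (fun _ => abs_setIntegral_mul_le Q z (fun t _ _ => z.norm_coe_le_norm t) (norm_nonneg z)))
      (fun Q₁ Q₂ z => by
        ext x
        simp only [BoundedContinuousFunction.coe_ofNormedAddCommGroup,
          BoundedContinuousFunction.coe_add, Pi.add_apply]
        rw [← integral_add (integrable_mul_bcf (integrable_potential Q₁) z).integrableOn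
          (integrable_mul_bcf (integrable_potential Q₂) z).integrableOn]
        refine integral_congr_ae (ae_restrict_of_ae ?_)
        filter_upwards [Lp.coeFn_add Q₁ Q₂] with t ht
        rw [ht, Pi.add_apply, add_mul])
      (fun c Q z => by
        ext x
        simp only [BoundedContinuousFunction.coe_ofNormedAddCommGroup,
          BoundedContinuousFunction.coe_smul, smul_eq_mul]
        rw [← integral_const_mul]
        refine integral_congr_ae (ae_restrict_of_ae ?_)
        filter_upwards [Lp.coeFn_smul c Q] with t ht
        rw [ht, Pi.smul_apply, smul_eq_mul, mul_assoc])
      (fun Q z₁ z₂ => by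
        ext x
        simp only [BoundedContinuousFunction.coe_ofNormedAddCommGroup,
          BoundedContinuousFunction.coe_add, Pi.add_apply, mul_add]
        rw [← integral_add (integrable_mul_bcf (integrable_potential Q) z₁).integrableOn
          (integrable_mul_bcf (integrable_potential Q) z₂).integrableOn])
      (fun c Q z => by
        ext x
        simp only [BoundedContinuousFunction.coe_ofNormedAddCommGroup,
          BoundedContinuousFunction.coe_smul, smul_eq_mul]
        rw [← integral_const_mul]
        refine integral_congr_ae (Eventually.of_forall fun t => ?_)
        ring))
    1
    (fun Q z => by
      rw [one_mul]
      exact BoundedContinuousFunction.norm_ofNormedAddCommGroup_le _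
        (mul_nonneg (norm_nonneg _) (norm_nonneg _))
        (fun _ => abs_setIntegral_mul_le Q z (fun t _ _ => z.norm_coe_le_norm t) (norm_nonneg z)))

lemma volterra_apply (Q : Potential ℓ) (z : ℝ →ᵇ ℝ) (x : ℝ) :
    volterra ℓ Q z x = ∫ t in Iic x, Q t * z t ∂(μI ℓ) := rfl

lemma volterra_apply_of_mem (Q : Potential ℓ) (z : ℝ →ᵇ ℝ) {x : ℝ} (hx : x ∈ Icc 0 ℓ) :
    volterra ℓ Q z x = ∫ t in (0 : ℝ)..x, Q t * z t := setIntegral_Iic_eq hx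

lemma volterra_apply_right (Q : Potential ℓ) (z : ℝ →ᵇ ℝ) :
    volterra ℓ Q z ℓ = ∫ t, Q t * z t ∂(μI ℓ) := setIntegral_Iic_of_ge le_rfl

lemma volterra_apply_zero (Q : Potential ℓ) (z : ℝ →ᵇ ℝ) (hℓ : 0 ≤ ℓ) : volterra ℓ Q z 0 = 0 := by
  rw [volterra_apply_of_mem Q z (left_mem_Icc.2 hℓ), intervalIntegral.integral_same]

lemma abs_volterra_le (Q : Potential ℓ) (z : ℝ →ᵇ ℝ) {x B : ℝ}
    (hB : ∀ t ∈ Icc 0 ℓ, t ≤ x → |z t| ≤ B) (hB0 : 0 ≤ B) : |volterra ℓ Q z x| ≤ ‖Q‖ * B :=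
  abs_setIntegral_mul_le Q z hB hB0

lemma norm_volterra_le_of_Icc (Q : Potential ℓ) (z : ℝ →ᵇ ℝ) {B : ℝ} (hℓ : 0 ≤ ℓ) (hB0 : 0 ≤ B)
    (hB : ∀ x ∈ Icc 0 ℓ, |volterra ℓ Q z x| ≤ B) : ‖volterra ℓ Q z‖ ≤ B := by
  rw [BoundedContinuousFunction.norm_le hB0]
  intro x
  rcases lt_or_ge x 0 with hx | hx
  · rw [volterra_apply, setIntegral_Iic_of_neg hx]; simpa
  rcases le_or_gt x ℓ with hx' | hx'
  · exact hB x ⟨hx, hx'⟩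
  · rw [volterra_apply, setIntegral_Iic_of_ge hx'.le, ← setIntegral_Iic_of_ge le_rfl]
    exact hB ℓ ⟨hℓ, le_rfl⟩

/-- The constant potential `1`. -/
def onePot (ℓ : ℝ) : Potential ℓ := Lp.const 1 (μI ℓ) (1 : ℝ)

lemma coeFn_onePot : (fun t => onePot ℓ t) =ᵐ[μI ℓ] fun _ => 1 := Lp.coeFn_const (μ := μI ℓ) 1 (1 : ℝ)

lemma coeFn_sub_smul_onePot (q : Potential ℓ) (c : ℝ) :
    (fun t => (q - c • onePot ℓ : Potential ℓ) t) =ᵐ[μI ℓ] fun t => q t - c := by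
  filter_upwards [Lp.coeFn_sub q (c • onePot ℓ), Lp.coeFn_smul c (onePot ℓ), coeFn_onePot (ℓ := ℓ)]
    with t h1 h2 h3
  rw [h1, Pi.sub_apply, h2, Pi.smul_apply, h3, smul_eq_mul, mul_one]

/-- Integration from `0`, continued by constants outside `[0, ℓ]`. -/
def primitive (ℓ : ℝ) : (ℝ →ᵇ ℝ) →L[ℝ] (ℝ →ᵇ ℝ) := volterra ℓ (onePot ℓ)

lemma integral_onePot_mul (z : ℝ → ℝ) : ∫ t, onePot ℓ t * z t ∂(μI ℓ) = ∫ t, z t ∂(μI ℓ) := by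
  refine integral_congr_ae ?_
  filter_upwards [coeFn_onePot (ℓ := ℓ)] with t ht
  rw [ht, one_mul]

lemma primitive_apply (z : ℝ →ᵇ ℝ) {x : ℝ} (hx : x ∈ Icc 0 ℓ) :
    primitive ℓ z x = ∫ t in (0 : ℝ)..x, z t := by
  rw [primitive, volterra_apply, ← setIntegral_Iic_eq hx]
  refine integral_congr_ae (ae_restrict_of_ae ?_)
  filter_upwards [coeFn_onePot (ℓ := ℓ)] with t ht
  rw [ht, one_mul]

lemma abs_primitive_volterra_le (Q : Potential ℓ) (z : ℝ →ᵇ ℝ) {C : ℝ} {n : ℕ}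
    (hC : 0 ≤ C) (hz : ∀ x ∈ Icc 0 ℓ, |z x| ≤ C * (x ^ n / n.factorial)) :
    ∀ x ∈ Icc 0 ℓ, |primitive ℓ (volterra ℓ Q z) x| ≤
      (C * ‖Q‖) * (x ^ (n + 1) / (n + 1).factorial) := by
  intro x hx
  have hv : ∀ t ∈ Icc 0 x, |volterra ℓ Q z t| ≤ (C * ‖Q‖) * (t ^ n / n.factorial) := by
    intro t ht
    have h0 : 0 ≤ C * (t ^ n / n.factorial) :=
      mul_nonneg hC (div_nonneg (pow_nonneg ht.1 n) (Nat.cast_nonneg _))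
    refine (abs_volterra_le Q z (B := C * (t ^ n / n.factorial)) ?_ h0).trans (by ring_nf; rfl)
    intro s hs hst
    refine (hz s hs).trans (mul_le_mul_of_nonneg_left ?_ hC)
    gcongr
    exact hs.1
  rw [primitive_apply _ hx]
  calc |∫ t in (0 : ℝ)..x, volterra ℓ Q z t|
      ≤ ∫ t in (0 : ℝ)..x, (C * ‖Q‖) * (t ^ n / n.factorial) := by
        rw [← Real.norm_eq_abs]
        refine intervalIntegral.norm_integral_le_of_norm_le hx.1 ?_ ?_
        · exact Eventually.of_forall fun t ht => hv t ⟨ht.1.le, ht.2⟩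
        · exact Continuous.intervalIntegrable (by fun_prop) _ _
    _ = _ := by
        rw [intervalIntegral.integral_const_mul, intervalIntegral.integral_div, integral_pow,
          Nat.factorial_succ]
        push_cast
        rw [zero_pow (Nat.succ_ne_zero n), sub_zero, div_div]

/-- The operator of the integral equation `z = z₀ + ∫∫ Q z` equivalent to `z'' = Q z`. -/
def picard (ℓ : ℝ) (Q : Potential ℓ) : (ℝ →ᵇ ℝ) →L[ℝ] (ℝ →ᵇ ℝ) := primitive ℓ ∘L volterra ℓ Q

/-- The factorial decay that makes Picard iteration converge, without smallness of `Q` or `ℓ`. -/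
lemma norm_picard_pow_le (Q : Potential ℓ) (hℓ : 0 ≤ ℓ) (n : ℕ) :
    ‖picard ℓ Q ^ (n + 1)‖ ≤ (‖Q‖ * ℓ) ^ (n + 1) / (n + 1).factorial := by
  have key : ∀ (n : ℕ) (z : ℝ →ᵇ ℝ), ∀ x ∈ Icc 0 ℓ,
      |(picard ℓ Q ^ n) z x| ≤ (‖Q‖ ^ n * ‖z‖) * (x ^ n / n.factorial) := by
    intro n
    induction n with
    | zero => intro z x _; simpa using z.norm_coe_le_norm x
    | succ n ih =>
      intro z x hx
      rw [pow_succ']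
      refine (abs_primitive_volterra_le Q _ (by positivity) (ih z) x hx).trans (le_of_eq ?_)
      ring
  have hc : 0 ≤ (‖Q‖ * ℓ) ^ (n + 1) / (n + 1).factorial := by positivity
  refine ContinuousLinearMap.opNorm_le_bound _ hc fun z => ?_
  have h := key (n + 1) z
  rw [pow_succ'] at h ⊢
  refine norm_volterra_le_of_Icc _ _ hℓ (by positivity) fun x hx => (h x hx).trans ?_
  rw [mul_pow]
  have : x ^ (n + 1) ≤ ℓ ^ (n + 1) := by gcongr; exacts [hx.1, hx.2]
  calc _ ≤ ‖Q‖ ^ (n + 1) * ‖z‖ * (ℓ ^ (n + 1) / (n + 1).factorial) := by gcongr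
    _ = _ := by ring

/-- `1 - a` is a factor of `1 - a ^ n`, commuting with the cofactor. -/
lemma isUnit_one_sub_of_isUnit_one_sub_pow {R : Type*} [Ring R] {a : R} {n : ℕ}
    (h : IsUnit (1 - a ^ n)) : IsUnit (1 - a) := by
  rw [← mul_neg_geom_sum] at h
  have hcomm : Commute (1 - a) (∑ i ∈ Finset.range n, a ^ i) := by
    refine Commute.sum_right _ _ _ fun i _ => ?_
    exact ((Commute.one_left _).sub_left (Commute.refl _)).pow_right i
  exact (hcomm.isUnit_mul_iff.1 h).1

lemma isUnit_one_sub_picard (Q : Potential ℓ) (hℓ : 0 ≤ ℓ) : IsUnit (1 - picard ℓ Q) := by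
  have hlim := (FloorSemiring.tendsto_pow_div_factorial_atTop (‖Q‖ * ℓ)).comp (tendsto_add_atTop_nat 1)
  obtain ⟨n, hn⟩ := (hlim.eventually_lt_const one_pos).exists
  have h1 : ‖picard ℓ Q ^ (n + 1)‖ < 1 := (norm_picard_pow_le Q hℓ n).trans_lt hn
  exact isUnit_one_sub_of_isUnit_one_sub_pow
    (isUnit_one_sub_of_norm_lt_one (R := (ℝ →ᵇ ℝ) →L[ℝ] (ℝ →ᵇ ℝ)) h1)

/-- The solution of `-z'' + Q z = 0`, `z 0 = a`, `z' 0 = b`. -/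
def solZ (ℓ a b : ℝ) (Q : Potential ℓ) : ℝ →ᵇ ℝ :=
  Ring.inverse (1 - picard ℓ Q) (a • 1 + b • primitive ℓ 1)

/-- The derivative of the solution `solZ ℓ a b Q`. -/
def solP (ℓ a b : ℝ) (Q : Potential ℓ) : ℝ →ᵇ ℝ := b • 1 + volterra ℓ Q (solZ ℓ a b Q)

lemma solZ_eq (hℓ : 0 ≤ ℓ) (a b : ℝ) (Q : Potential ℓ) :
    solZ ℓ a b Q = a • 1 + primitive ℓ (solP ℓ a b Q) := by
  have h : (1 - picard ℓ Q) (solZ ℓ a b Q) = a • 1 + b • primitive ℓ 1 := by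
    rw [solZ, ← mul_apply_eq_comp, Ring.mul_inverse_cancel _ (isUnit_one_sub_picard Q hℓ)]
    rfl
  have h2 : solZ ℓ a b Q = (a • 1 + b • primitive ℓ 1) + picard ℓ Q (solZ ℓ a b Q) := by
    rw [← h]; simp
  conv_lhs => rw [h2]
  rw [solP, map_add, map_smul, add_assoc]
  rfl

lemma contDiff_solZ (hℓ : 0 ≤ ℓ) (a b : ℝ) : ContDiff ℝ ∞ (solZ ℓ a b) := by
  rw [contDiff_iff_contDiffAt]
  intro Q
  have hp : ContDiff ℝ ∞ (fun Q : Potential ℓ => 1 - picard ℓ Q) := by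
    refine contDiff_const.sub ?_
    have hv : ContDiff ℝ ∞ (fun Q : Potential ℓ => volterra ℓ Q) := by fun_prop
    exact contDiff_const.clm_comp hv
  obtain ⟨u, hu⟩ := isUnit_one_sub_picard Q hℓ
  have hinv : ContDiffAt ℝ ∞ (fun Q : Potential ℓ => Ring.inverse (1 - picard ℓ Q)) Q := by
    refine ContDiffAt.comp (g := Ring.inverse) Q ?_ hp.contDiffAt
    rw [← hu]
    exact contDiffAt_ringInverse ℝ (R := (ℝ →ᵇ ℝ) →L[ℝ] (ℝ →ᵇ ℝ)) u
  exact hinv.clm_apply contDiffAt_const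

lemma contDiff_solP (hℓ : 0 ≤ ℓ) (a b : ℝ) : ContDiff ℝ ∞ (solP ℓ a b) :=
  contDiff_const.add ((volterra ℓ).contDiff.clm_apply (contDiff_solZ hℓ a b))

lemma solZ_zero (hℓ : 0 ≤ ℓ) (a b : ℝ) (Q : Potential ℓ) : solZ ℓ a b Q 0 = a := by
  rw [solZ_eq hℓ, BoundedContinuousFunction.add_apply, primitive, volterra_apply_zero _ _ hℓ]
  simp

lemma solP_zero (hℓ : 0 ≤ ℓ) (a b : ℝ) (Q : Potential ℓ) : solP ℓ a b Q 0 = b := by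
  rw [solP, BoundedContinuousFunction.add_apply, volterra_apply_zero _ _ hℓ]
  simp

/-- The derivative `H ↦ ż` of `Q ↦ solZ ℓ a b Q` in the direction `H`. -/
def varZ (ℓ a b : ℝ) (Q H : Potential ℓ) : ℝ →ᵇ ℝ := fderiv ℝ (solZ ℓ a b) Q H

/-- The derivative `H ↦ ṗ` of `Q ↦ solP ℓ a b Q` in the direction `H`. -/
def varP (ℓ a b : ℝ) (Q H : Potential ℓ) : ℝ →ᵇ ℝ := fderiv ℝ (solP ℓ a b) Q H

lemma hasFDerivAt_solZ (hℓ : 0 ≤ ℓ) (a b : ℝ) (Q : Potential ℓ) :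
    HasFDerivAt (solZ ℓ a b) (fderiv ℝ (solZ ℓ a b) Q) Q :=
  ((contDiff_solZ hℓ a b).differentiable (by simp) Q).hasFDerivAt

lemma hasFDerivAt_solP (hℓ : 0 ≤ ℓ) (a b : ℝ) (Q : Potential ℓ) :
    HasFDerivAt (solP ℓ a b) (fderiv ℝ (solP ℓ a b) Q) Q :=
  ((contDiff_solP hℓ a b).differentiable (by simp) Q).hasFDerivAt

lemma varZ_eq (hℓ : 0 ≤ ℓ) (a b : ℝ) (Q H : Potential ℓ) :
    varZ ℓ a b Q H = primitive ℓ (varP ℓ a b Q H) := by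
  have h := (primitive ℓ).hasFDerivAt.comp Q (hasFDerivAt_solP hℓ a b Q)
  have h2 := h.const_add (a • (1 : ℝ →ᵇ ℝ))
  have h3 : (fun Q => a • (1 : ℝ →ᵇ ℝ) + (primitive ℓ ∘ solP ℓ a b) Q) = solZ ℓ a b := by
    funext Q; exact (solZ_eq hℓ a b Q).symm
  rw [h3] at h2
  rw [varZ, h2.fderiv]; rfl

lemma varP_eq (hℓ : 0 ≤ ℓ) (a b : ℝ) (Q H : Potential ℓ) :
    varP ℓ a b Q H = volterra ℓ H (solZ ℓ a b Q) + volterra ℓ Q (varZ ℓ a b Q H) := by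
  have h := (volterra ℓ).hasFDerivAt (x := Q) |>.clm_apply (hasFDerivAt_solZ hℓ a b Q)
  have h2 : HasFDerivAt (solP ℓ a b) _ Q := h.const_add (b • (1 : ℝ →ᵇ ℝ))
  rw [varP, h2.fderiv]
  simp [varZ, add_comm]

/-! ### Carathéodory solutions and the Lagrange identity -/

/-- `-z'' + Q z = f` as a first-order system for the absolutely continuous pair `(z, p)`, `p = z'`. -/
structure IsSolPair (ℓ : ℝ) (Q f z p : ℝ → ℝ) : Prop where
  fst : HasACDeriv ℓ z p
  snd : HasACDeriv ℓ p (fun x => Q x * z x - f x)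

namespace IsSolPair

variable {Q f f₁ f₂ z z₁ z₂ p p₁ p₂ : ℝ → ℝ}

lemma hasDerivWithinAt (h : IsSolPair ℓ Q f z p) {x : ℝ} (hx : x ∈ Icc 0 ℓ) :
    HasDerivWithinAt z (p x) (Icc 0 ℓ) x := by
  have hℓ : 0 ≤ ℓ := hx.1.trans hx.2
  have hpc := h.snd.continuousOn
  have hc : Continuous (IccExtend hℓ (domRestrict (Icc 0 ℓ) p)) := by
    rw [continuous_IccExtend_iff]; exact hpc.domRestrict
  have heq : ∀ y ∈ Icc 0 ℓ, IccExtend hℓ (domRestrict (Icc 0 ℓ) p) y = p y := fun y hy => by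
    rw [IccExtend_of_mem hℓ _ hy]; rfl
  have h1 := (intervalIntegral.integral_hasDerivAt_right (hc.intervalIntegrable 0 x)
    hc.stronglyMeasurable.stronglyMeasurableAtFilter hc.continuousAt).const_add (z 0)
  rw [heq x hx] at h1
  refine h1.hasDerivWithinAt.congr_of_mem (fun y hy => ?_) hx
  have h2 := h.fst.integral_eq_sub le_rfl hy.1 hy.2
  rw [← add_sub_cancel (z 0) (z y), ← h2]
  congr 1
  refine intervalIntegral.integral_congr fun t ht => ?_
  rw [uIcc_of_le hy.1] at ht
  exact (heq t ⟨ht.1, ht.2.trans hy.2⟩).symm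

lemma dI_eqOn (hℓ : 0 < ℓ) (h : IsSolPair ℓ Q f z p) : EqOn (dI ℓ z) p (Icc 0 ℓ) := fun _ hx =>
  (h.hasDerivWithinAt hx).derivWithin (uniqueDiffOn_Icc hℓ _ hx)

lemma isSolution (hℓ : 0 < ℓ) (h : IsSolPair ℓ Q f z p) : IsSolution ℓ Q f z := by
  have h2 := h.snd.congr (h.dI_eqOn hℓ).symm hℓ.le
  exact ⟨fun x hx => (h.hasDerivWithinAt hx).differentiableWithinAt, h2.ac, h2.deriv⟩

lemma congr_ae {Q' f' : ℝ → ℝ} (h : IsSolPair ℓ Q f z p)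
    (he : (fun x => Q x * z x - f x) =ᵐ[μI ℓ] fun x => Q' x * z x - f' x) :
    IsSolPair ℓ Q' f' z p := ⟨h.fst, h.snd.congr_deriv he⟩

lemma sub (h₁ : IsSolPair ℓ Q f₁ z₁ p₁) (h₂ : IsSolPair ℓ Q f₂ z₂ p₂) :
    IsSolPair ℓ Q (fun x => f₁ x - f₂ x) (fun x => z₁ x - z₂ x) (fun x => p₁ x - p₂ x) :=
  ⟨h₁.fst.sub h₂.fst, (h₁.snd.sub h₂.snd).congr_deriv (Eventually.of_forall fun x => by
    simp only; ring)⟩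

lemma const_mul (c : ℝ) (h : IsSolPair ℓ Q f z p) :
    IsSolPair ℓ Q (fun x => c * f x) (fun x => c * z x) (fun x => c * p x) :=
  ⟨h.fst.const_mul c, (h.snd.const_mul c).congr_deriv (Eventually.of_forall fun x => by
    simp only; ring)⟩

/-- The Lagrange identity (Green's formula) on `[0, x]`. -/
lemma lagrange (h₁ : IsSolPair ℓ Q f₁ z₁ p₁) (h₂ : IsSolPair ℓ Q f₂ z₂ p₂) {x : ℝ}
    (hx : x ∈ Icc 0 ℓ) :
    p₁ x * z₂ x - z₁ x * p₂ x - (p₁ 0 * z₂ 0 - z₁ 0 * p₂ 0) =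
      ∫ t in (0 : ℝ)..x, (z₁ t * f₂ t - f₁ t * z₂ t) := by
  have h := ((h₁.snd.mul h₂.fst).sub (h₁.fst.mul h₂.snd)).congr_deriv
    (g' := fun t => z₁ t * f₂ t - f₁ t * z₂ t) (Eventually.of_forall fun t => by simp only; ring)
  exact (h.integral_eq_sub le_rfl hx.1 hx.2).symm

/-- Variation of constants: an inhomogeneous solution with zero initial data is determined by the
fundamental solutions. -/
lemma eq_integral (h : IsSolPair ℓ Q f z p) (h0 : z 0 = 0) (h0' : p 0 = 0)
    (h₁ : IsSolPair ℓ Q (fun _ => 0) z₁ p₁) (h₂ : IsSolPair ℓ Q (fun _ => 0) z₂ p₂)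
    (ha : z₁ 0 = 1) (ha' : p₁ 0 = 0) (hb : z₂ 0 = 0) (hb' : p₂ 0 = 1) {x : ℝ}
    (hx : x ∈ Icc 0 ℓ) :
    z x = ∫ y in (0 : ℝ)..x, kernelW z₁ z₂ x y * f y := by
  have hχ := (h₂.const_mul (z₁ x)).sub (h₁.const_mul (z₂ x))
  have hL := h.lagrange hχ hx
  have hW := h₁.lagrange h₂ hx
  simp only [mul_zero, sub_zero, zero_mul, ha, ha', hb, hb', h0, h0',
    intervalIntegral.integral_zero, mul_one, zero_sub] at hL hW
  have hz : z x = z x * (z₁ x * p₂ x - z₂ x * p₁ x) := by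
    have : z₁ x * p₂ x - z₂ x * p₁ x = 1 := by linarith
    rw [this, mul_one]
  have hz' : z x = -∫ t in (0 : ℝ)..x, -(f t * (z₁ x * z₂ t - z₂ x * z₁ t)) := by
    linarith
  rw [hz', intervalIntegral.integral_neg, neg_neg]
  refine intervalIntegral.integral_congr fun t _ => ?_
  simp only [kernelW]; ring

end IsSolPair

lemma IsSolution.isSolPair {Q f z : ℝ → ℝ} (hℓ : 0 < ℓ) (h : IsSolution ℓ Q f z) :
    IsSolPair ℓ Q f z (dI ℓ z) := by
  have hu := uniqueDiffOn_Icc hℓ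
  refine ⟨⟨?_, ?_⟩, h.absolutelyContinuous, h.equation⟩
  · have hc : ContinuousOn (derivWithin z (Icc 0 ℓ)) (Icc 0 ℓ) := by
      have := h.absolutelyContinuous.continuousOn
      rwa [uIcc_of_le hℓ.le] at this
    have : ContDiffOn ℝ 1 z (uIcc 0 ℓ) := by
      rw [uIcc_of_le hℓ.le, show (1 : WithTop ℕ∞) = 0 + 1 by simp, contDiffOn_succ_iff_derivWithin hu]
      exact ⟨h.differentiableOn, by simp, contDiffOn_zero.2 hc⟩
    exact this.absolutelyContinuousOnInterval
  · filter_upwards [ae_muI_mem_Ioo (ℓ := ℓ)] with x hx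
    exact ((h.differentiableOn x ⟨hx.1.le, hx.2.le⟩).hasDerivWithinAt).hasDerivAt
      (Icc_mem_nhds hx.1 hx.2)

lemma isSolPair_sol (hℓ : 0 ≤ ℓ) (a b : ℝ) (Q : Potential ℓ) :
    IsSolPair ℓ Q (fun _ => 0) (solZ ℓ a b Q) (solP ℓ a b Q) := by
  constructor
  · refine hasACDeriv_of_eq_integral hℓ (c := a) ?_ fun x hx => ?_
    · exact ((solP ℓ a b Q).continuous.integrableOn_Icc)
    · conv_lhs => rw [solZ_eq hℓ]
      rw [BoundedContinuousFunction.add_apply, primitive_apply _ hx]; simp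
  · refine hasACDeriv_of_eq_integral hℓ (c := b) ?_ fun x hx => ?_
    · simpa using integrable_mul_bcf (integrable_potential Q) (solZ ℓ a b Q)
    · rw [solP, BoundedContinuousFunction.add_apply, volterra_apply_of_mem _ _ hx]; simp

/-- The derivative of the solution with respect to the potential solves the linearized equation. -/
lemma isSolPair_var (hℓ : 0 ≤ ℓ) (a b : ℝ) (Q H : Potential ℓ) :
    IsSolPair ℓ Q (fun x => -(H x * solZ ℓ a b Q x)) (varZ ℓ a b Q H) (varP ℓ a b Q H) := by
  constructor
  · refine hasACDeriv_of_eq_integral hℓ (c := 0) ?_ fun x hx => ?_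
    · exact ((varP ℓ a b Q H).continuous.integrableOn_Icc)
    · conv_lhs => rw [varZ_eq hℓ]
      rw [primitive_apply _ hx, zero_add]
  · have h1 := integrable_mul_bcf (integrable_potential Q) (varZ ℓ a b Q H)
    have h2 := integrable_mul_bcf (integrable_potential H) (solZ ℓ a b Q)
    refine hasACDeriv_of_eq_integral hℓ (c := 0) ?_ fun x hx => ?_
    · exact (h1.add h2).congr (Eventually.of_forall fun x => by simp)
    · rw [varP_eq hℓ, BoundedContinuousFunction.add_apply, volterra_apply_of_mem _ _ hx,
        volterra_apply_of_mem _ _ hx, zero_add,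
        ← intervalIntegral.integral_add
          (intervalIntegrable_of_integrable h2 (left_mem_Icc.2 hℓ) hx)
          (intervalIntegrable_of_integrable h1 (left_mem_Icc.2 hℓ) hx)]
      refine intervalIntegral.integral_congr fun t _ => ?_
      ring

lemma varZ_zero (hℓ : 0 ≤ ℓ) (a b : ℝ) (Q H : Potential ℓ) : varZ ℓ a b Q H 0 = 0 := by
  rw [varZ_eq hℓ, primitive, volterra_apply_zero _ _ hℓ]

lemma varP_zero (hℓ : 0 ≤ ℓ) (a b : ℝ) (Q H : Potential ℓ) : varP ℓ a b Q H 0 = 0 := by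
  rw [varP_eq hℓ, BoundedContinuousFunction.add_apply, volterra_apply_zero _ _ hℓ,
    volterra_apply_zero _ _ hℓ, add_zero]

/-- Uniqueness for the initial value problem of an inhomogeneous equation, for the pair `(z, z')`. -/
lemma IsSolPair.eqOn (Q : Potential ℓ) {f z p w r : ℝ → ℝ}
    (hz : IsSolPair ℓ Q f z p) (hw : IsSolPair ℓ Q f w r) (h0 : z 0 = w 0) (h0' : p 0 = r 0) :
    EqOn z w (Icc 0 ℓ) := by
  intro x hx
  have hℓ : 0 ≤ ℓ := hx.1.trans hx.2
  have h := (hz.sub hw).eq_integral (by simp [h0]) (by simp [h0']) (isSolPair_sol hℓ 1 0 Q)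
    (isSolPair_sol hℓ 0 1 Q) (solZ_zero hℓ _ _ _) (solP_zero hℓ _ _ _) (solZ_zero hℓ _ _ _)
    (solP_zero hℓ _ _ _) hx
  simp only [sub_self, mul_zero, intervalIntegral.integral_zero] at h
  linarith

/-- The initial value problem for `z'' = (q - c) z - f` is uniquely solved by any solution pair of
the equation with the potential `q - c`. -/
lemma isUniqueOn_ivp (hℓ : 0 < ℓ) (q : Potential ℓ) (c : ℝ) {f z p : ℝ → ℝ} {a b : ℝ}
    (h : IsSolPair ℓ (q - c • onePot ℓ : Potential ℓ) f z p) (ha : z 0 = a) (hb : p 0 = b) :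
    IsUniqueOn ℓ (IsIVPSolution ℓ (fun x => q x - c) f a b) z := by
  have hQ := coeFn_sub_smul_onePot q c
  have hz : IsSolPair ℓ (fun x => q x - c) f z p := h.congr_ae (by
    filter_upwards [hQ] with x hx; rw [hx])
  have h0 : (0 : ℝ) ∈ Icc 0 ℓ := left_mem_Icc.2 hℓ.le
  refine ⟨⟨hz.isSolution hℓ, ha, by rw [hz.dI_eqOn hℓ h0, hb]⟩, fun w hw => ?_⟩
  have hw' : IsSolPair ℓ (q - c • onePot ℓ : Potential ℓ) f w (dI ℓ w) :=
    (hw.1.isSolPair hℓ).congr_ae (by filter_upwards [hQ] with x hx; rw [hx])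
  exact hw'.eqOn _ h (by rw [hw.2.1, ha]) (by rw [hw.2.2, hb])

lemma solPair_ne_zero (hℓ : 0 ≤ ℓ) {a b : ℝ} (hab : a ≠ 0 ∨ b ≠ 0) (Q : Potential ℓ) {x : ℝ}
    (hx : x ∈ Icc 0 ℓ) : 0 < solP ℓ a b Q x ^ 2 + solZ ℓ a b Q x ^ 2 := by
  -- The Wronskians of the solution with the two fundamental solutions are constant.
  have h := isSolPair_sol hℓ a b Q
  have h1 := h.lagrange (isSolPair_sol hℓ 1 0 Q) hx
  have h2 := h.lagrange (isSolPair_sol hℓ 0 1 Q) hx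
  simp only [solZ_zero hℓ, solP_zero hℓ, mul_zero, zero_mul, sub_zero,
    intervalIntegral.integral_zero, mul_one, zero_sub] at h1 h2
  by_contra hcon
  have hp : solP ℓ a b Q x = 0 := by nlinarith [sq_nonneg (solP ℓ a b Q x), sq_nonneg (solZ ℓ a b Q x)]
  have hz : solZ ℓ a b Q x = 0 := by nlinarith [sq_nonneg (solP ℓ a b Q x), sq_nonneg (solZ ℓ a b Q x)]
  rw [hp, hz] at h1 h2
  rcases hab with h | h
  · exact h (by linarith)
  · exact h (by linarith)

/-! ### The boundary function and its derivative -/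

/-- The solution with initial data `(sin α, cos α)`, which satisfies the condition at `0`. -/
abbrev shootZ (ℓ α : ℝ) (Q : Potential ℓ) : ℝ →ᵇ ℝ := solZ ℓ (Real.sin α) (Real.cos α) Q

/-- The derivative of `shootZ ℓ α Q`. -/
abbrev shootP (ℓ α : ℝ) (Q : Potential ℓ) : ℝ →ᵇ ℝ := solP ℓ (Real.sin α) (Real.cos α) Q

/-- The boundary form at `ℓ` with angle `γ`, evaluated on the solution that satisfies the condition
at `0`. Its zeros `q - λ` (for `γ = β`) give the eigenvalues `λ`. -/
def bdry (ℓ α γ : ℝ) (Q : Potential ℓ) : ℝ :=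
  shootZ ℓ α Q ℓ * Real.cos γ - shootP ℓ α Q ℓ * Real.sin γ

lemma sin_ne_zero_or_cos_ne_zero (α : ℝ) : Real.sin α ≠ 0 ∨ Real.cos α ≠ 0 := by
  by_contra! h
  have := Real.sin_sq_add_cos_sq α
  rw [h.1, h.2] at this; norm_num at this

lemma shoot_sq_pos (hℓ : 0 ≤ ℓ) (α : ℝ) (Q : Potential ℓ) {x : ℝ} (hx : x ∈ Icc 0 ℓ) :
    0 < shootP ℓ α Q x ^ 2 + shootZ ℓ α Q x ^ 2 :=
  solPair_ne_zero hℓ (sin_ne_zero_or_cos_ne_zero α) Q hx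

lemma contDiff_eval (x : ℝ) : ContDiff ℝ ∞ (fun z : ℝ →ᵇ ℝ => z x) :=
  ContinuousLinearMap.contDiff (BoundedContinuousFunction.evalCLM ℝ x : (ℝ →ᵇ ℝ) →L[ℝ] ℝ)

lemma contDiff_bdry (hℓ : 0 ≤ ℓ) (α γ : ℝ) : ContDiff ℝ ∞ (bdry ℓ α γ) :=
  (((contDiff_eval ℓ).comp (contDiff_solZ hℓ _ _)).mul contDiff_const).sub
    (((contDiff_eval ℓ).comp (contDiff_solP hℓ _ _)).mul contDiff_const)

lemma hasFDerivAt_bdry (hℓ : 0 ≤ ℓ) (α γ : ℝ) (Q : Potential ℓ) :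
    HasFDerivAt (bdry ℓ α γ) (fderiv ℝ (bdry ℓ α γ) Q) Q :=
  ((contDiff_bdry hℓ α γ).differentiable (by simp) Q).hasFDerivAt

lemma fderiv_bdry (hℓ : 0 ≤ ℓ) (α γ : ℝ) (Q H : Potential ℓ) :
    fderiv ℝ (bdry ℓ α γ) Q H =
      varZ ℓ (Real.sin α) (Real.cos α) Q H ℓ * Real.cos γ -
        varP ℓ (Real.sin α) (Real.cos α) Q H ℓ * Real.sin γ := by
  have h1 := (BoundedContinuousFunction.evalCLM ℝ ℓ (β := ℝ)).hasFDerivAt.comp Q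
    (hasFDerivAt_solZ hℓ (Real.sin α) (Real.cos α) Q)
  have h2 := (BoundedContinuousFunction.evalCLM ℝ ℓ (β := ℝ)).hasFDerivAt.comp Q
    (hasFDerivAt_solP hℓ (Real.sin α) (Real.cos α) Q)
  have h : HasFDerivAt (bdry ℓ α γ) _ Q :=
    (h1.mul_const (Real.cos γ)).sub (h2.mul_const (Real.sin γ))
  rw [h.fderiv]
  simp [varZ, varP, mul_comm]

/-- The quadratic functional `H ↦ ∫ H z²` attached to a solution `z`. -/
def weight (ℓ : ℝ) (z : ℝ →ᵇ ℝ) (H : Potential ℓ) : ℝ := volterra ℓ H (z * z) ℓ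

lemma weight_eq (z : ℝ →ᵇ ℝ) (H : Potential ℓ) : weight ℓ z H = ∫ t, H t * (z t * z t) ∂(μI ℓ) :=
  volterra_apply_right H (z * z)

lemma weight_onePot (z : ℝ →ᵇ ℝ) : weight ℓ z (onePot ℓ) = ∫ t, z t * z t ∂(μI ℓ) := by
  rw [weight_eq, integral_onePot_mul (fun t => z t * z t)]

/-- Lagrange identity between a solution and its variation in the direction `H`. -/
lemma wronskian_var (hℓ : 0 ≤ ℓ) (a b : ℝ) (Q H : Potential ℓ) :
    solP ℓ a b Q ℓ * varZ ℓ a b Q H ℓ - solZ ℓ a b Q ℓ * varP ℓ a b Q H ℓ =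
      -weight ℓ (solZ ℓ a b Q) H := by
  have h := (isSolPair_sol hℓ a b Q).lagrange (isSolPair_var hℓ a b Q H) (right_mem_Icc.2 hℓ)
  rw [varZ_zero hℓ, varP_zero hℓ, mul_zero, mul_zero, sub_zero, sub_zero] at h
  rw [h, weight_eq, ← setIntegral_Iic_of_ge le_rfl, setIntegral_Iic_eq (right_mem_Icc.2 hℓ),
    ← intervalIntegral.integral_neg]
  refine intervalIntegral.integral_congr fun t _ => ?_
  ring

/-- At a zero of the boundary function its derivative is a nonzero multiple of `H ↦ ∫ H z²`. -/
lemma fderiv_bdry_of_eq_zero (hℓ : 0 ≤ ℓ) {α γ : ℝ} {Q : Potential ℓ} (h0 : bdry ℓ α γ Q = 0)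
    (H : Potential ℓ) :
    (shootZ ℓ α Q ℓ * Real.sin γ + shootP ℓ α Q ℓ * Real.cos γ) * fderiv ℝ (bdry ℓ α γ) Q H =
      -weight ℓ (shootZ ℓ α Q) H := by
  rw [← wronskian_var hℓ, fderiv_bdry hℓ]
  rw [bdry] at h0
  have hsc := Real.sin_sq_add_cos_sq γ
  set z := shootZ ℓ α Q ℓ
  set p := shootP ℓ α Q ℓ
  set dz := varZ ℓ (Real.sin α) (Real.cos α) Q H ℓ
  set dp := varP ℓ (Real.sin α) (Real.cos α) Q H ℓ
  -- `(z, p)` is proportional to `(sin γ, cos γ)`.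
  linear_combination (p * dz - z * dp) * hsc + (dz * Real.sin γ + dp * Real.cos γ) * h0

lemma weight_onePot_pos (hℓ : 0 < ℓ) {a b : ℝ} (hab : a ≠ 0 ∨ b ≠ 0) (Q : Potential ℓ) :
    0 < weight ℓ (solZ ℓ a b Q) (onePot ℓ) := by
  rw [weight_onePot]
  set z := solZ ℓ a b Q with hz
  refine lt_of_le_of_ne (integral_nonneg fun t => mul_self_nonneg _) fun h => ?_
  have hc : Continuous fun t => z t * z t := z.continuous.mul z.continuous
  have h0 := (integral_eq_zero_iff_of_nonneg (fun t => mul_self_nonneg (z t))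
    (hc.integrableOn_Icc)).1 h.symm
  have hzero : EqOn (fun t => z t * z t) 0 (Icc 0 ℓ) :=
    Measure.eqOn_Icc_of_ae_eq _ hℓ.ne h0 hc.continuousOn continuousOn_const
  have hz0 : EqOn z (fun _ => 0) (Icc 0 ℓ) := fun x hx => mul_self_eq_zero.1 (hzero hx)
  have hmem : (0 : ℝ) ∈ Icc 0 ℓ := left_mem_Icc.2 hℓ.le
  have h1 := (isSolPair_sol hℓ.le a b Q).hasDerivWithinAt hmem
  have h2 : HasDerivWithinAt z 0 (Icc 0 ℓ) 0 :=
    (hasDerivWithinAt_const (0 : ℝ) (Icc 0 ℓ) (0 : ℝ)).congr_of_mem hz0 hmem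
  have h3 := (uniqueDiffOn_Icc hℓ 0 hmem).eq_deriv _ h1 h2
  have h4 := solPair_ne_zero hℓ.le hab Q hmem
  rw [h3, ← hz, hz0 hmem] at h4
  norm_num at h4

/-! ### The Prüfer angle -/

lemma HasACDeriv.integrable_mul {f f' u : ℝ → ℝ} (hf : HasACDeriv ℓ f f') (hℓ : 0 ≤ ℓ)
    (hu : ContinuousOn u (Icc 0 ℓ)) : Integrable (fun x => u x * f' x) (μI ℓ) :=
  IntegrableOn.continuousOn_mul hu (hf.integrable hℓ) isCompact_Icc

/-- Polar coordinates for an absolutely continuous curve `(a, b)` in the punctured plane: the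
primitive of `(a b' - a' b) / (a² + b²)` is a continuous choice of the angle. -/
lemma exists_polar_angle (hℓ : 0 ≤ ℓ) {a a' b b' : ℝ → ℝ} (ha : HasACDeriv ℓ a a')
    (hb : HasACDeriv ℓ b b') (hpos : ∀ x ∈ Icc 0 ℓ, 0 < a x ^ 2 + b x ^ 2) {r₀ θ₀ : ℝ}
    (hr₀ : 0 < r₀) (ha0 : a 0 = r₀ * Real.cos θ₀) (hb0 : b 0 = r₀ * Real.sin θ₀) :
    ∃ Θ : ℝ → ℝ, ContinuousOn Θ (Icc 0 ℓ) ∧ Θ 0 = θ₀ ∧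
      Integrable (fun x => (a x * b' x - a' x * b x) / (a x ^ 2 + b x ^ 2)) (μI ℓ) ∧
      Θ ℓ = θ₀ + ∫ x, (a x * b' x - a' x * b x) / (a x ^ 2 + b x ^ 2) ∂(μI ℓ) ∧
      ∀ x ∈ Icc 0 ℓ, a x = Real.sqrt (a x ^ 2 + b x ^ 2) * Real.cos (Θ x) ∧
        b x = Real.sqrt (a x ^ 2 + b x ^ 2) * Real.sin (Θ x) := by
  have hne : ∀ x ∈ Icc 0 ℓ, a x ^ 2 + b x ^ 2 ≠ 0 := fun x hx => (hpos x hx).ne'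
  have hρc : ContinuousOn (fun x => a x ^ 2 + b x ^ 2) (Icc 0 ℓ) :=
    (ha.continuousOn.pow 2).add (hb.continuousOn.pow 2)
  have hint : Integrable (fun x => (a x * b' x - a' x * b x) / (a x ^ 2 + b x ^ 2)) (μI ℓ) := by
    have h1 := hb.integrable_mul hℓ (ha.continuousOn.div hρc hne)
    have h2 := ha.integrable_mul hℓ (hb.continuousOn.div hρc hne)
    refine (h1.sub h2).congr (Eventually.of_forall fun x => ?_)
    simp only [Pi.sub_apply, Pi.div_apply]; ring
  obtain ⟨g, hg⟩ : ∃ g, g = fun x => (a x * b' x - a' x * b x) / (a x ^ 2 + b x ^ 2) := ⟨_, rfl⟩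
  rw [← hg] at hint ⊢
  have hΘ := hasACDeriv_integral hℓ hint θ₀
  refine ⟨_, hΘ.continuousOn, by simp, hint, ?_, ?_⟩
  · rw [← setIntegral_Iic_eq (right_mem_Icc.2 hℓ), setIntegral_Iic_of_ge le_rfl]
  set Θ := fun x => θ₀ + ∫ t in (0 : ℝ)..x, g t with hΘdef
  have hΘ0 : Θ 0 = θ₀ := by simp [hΘdef]
  have hC := (ha.mul hΘ.cos).add (hb.mul hΘ.sin)
  have hS := (hb.mul hΘ.cos).sub (ha.mul hΘ.sin)
  have hρ := (ha.mul ha).add (hb.mul hb)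
  have hρpos : ∀ x ∈ Icc 0 ℓ, 0 < a x * a x + b x * b x := fun x hx => by
    have := hpos x hx; nlinarith
  have hF := (hS.mul hS).mul (hρ.inv (by rwa [uIcc_of_le hℓ]))
  have hF0 : ∀ x ∈ Icc 0 ℓ, b x * Real.cos (Θ x) - a x * Real.sin (Θ x) = 0 := by
    intro x hx
    have h := hF.eq_of_deriv_zero ?_ hx
    · have h00 : b 0 * Real.cos (Θ 0) - a 0 * Real.sin (Θ 0) = 0 := by
        rw [hΘ0, ha0, hb0]
        ring
      rw [h00] at h
      simpa [(hρpos x hx).ne'] using h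
    · filter_upwards [ae_muI_mem_Ioo (ℓ := ℓ)] with t ht
      have h1 := hρpos t ⟨ht.1.le, ht.2.le⟩
      have h2 : g t * (a t * a t + b t * b t) = a t * b' t - a' t * b t := by
        rw [hg]
        have h3 : a t ^ 2 + b t ^ 2 = a t * a t + b t * b t := by ring
        simp only [h3]
        exact div_mul_cancel₀ _ h1.ne'
      set S := b t * Real.cos (Θ t) - a t * Real.sin (Θ t) with hSt
      have h3 : (b' t * Real.cos (Θ t) + b t * (-Real.sin (Θ t) * g t) -
          (a' t * Real.sin (Θ t) + a t * (Real.cos (Θ t) * g t))) * (a t * a t + b t * b t) =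
          S * (a' t * a t + b' t * b t) := by
        rw [hSt]
        linear_combination (-b t * Real.sin (Θ t) - a t * Real.cos (Θ t)) * h2
      have key : ∀ S S' ρ m : ℝ, ρ ≠ 0 → S' * ρ = S * m →
          (S' * S + S * S') * ρ⁻¹ + S * S * (-(ρ ^ 2)⁻¹ * (m + m)) = 0 := by
        intro S S' ρ m hρ h
        rw [eq_div_of_mul_eq hρ h]
        field_simp
        ring
      rw [← key _ _ _ _ h1.ne' h3]
      ring
  have hCpos : ∀ x ∈ Icc 0 ℓ, 0 < a x * Real.cos (Θ x) + b x * Real.sin (Θ x) := by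
    have hCne : ∀ x ∈ Icc 0 ℓ, a x * Real.cos (Θ x) + b x * Real.sin (Θ x) ≠ 0 := by
      intro x hx h
      have h1 := hF0 x hx
      have h2 := hρpos x hx
      have h3 := Real.sin_sq_add_cos_sq (Θ x)
      have h4 : a x * a x + b x * b x = 0 := by
        linear_combination (-(a x * a x + b x * b x)) * h3 +
          (a x * Real.cos (Θ x) + b x * Real.sin (Θ x)) * h +
          (b x * Real.cos (Θ x) - a x * Real.sin (Θ x)) * h1
      linarith
    have h00 : 0 < a 0 * Real.cos (Θ 0) + b 0 * Real.sin (Θ 0) := by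
      rw [hΘ0, ha0, hb0]
      have h3 := Real.sin_sq_add_cos_sq θ₀
      have : r₀ * Real.cos θ₀ * Real.cos θ₀ + r₀ * Real.sin θ₀ * Real.sin θ₀ = r₀ := by
        linear_combination r₀ * h3
      rwa [this]
    intro x hx
    by_contra! hcon
    obtain ⟨y, hy, hy0⟩ := isPreconnected_Icc.intermediate_value hx (left_mem_Icc.2 hℓ)
      hC.continuousOn ⟨hcon, h00.le⟩
    exact hCne y hy hy0
  intro x hx
  have h1 := hF0 x hx
  have h2 := hCpos x hx
  have h3 := Real.sin_sq_add_cos_sq (Θ x)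
  have hr : Real.sqrt (a x ^ 2 + b x ^ 2) = a x * Real.cos (Θ x) + b x * Real.sin (Θ x) := by
    rw [Real.sqrt_eq_iff_mul_self_eq (hpos x hx).le h2.le]
    linear_combination (b x * Real.cos (Θ x) - a x * Real.sin (Θ x)) * h1 -
      (a x ^ 2 + b x ^ 2) * h3
  rw [hr]
  constructor
  · linear_combination (-a x) * h3 - Real.sin (Θ x) * h1
  · linear_combination (-b x) * h3 + Real.cos (Θ x) * h1

/-- The Prüfer angle at `ℓ` of the solution that satisfies the boundary condition at `0`: the angle
of `(z', z)`, which is `α` at `0`. It is defined as the integral of its derivative, which determines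
it without a choice modulo `2 π`. -/
def prueferAngle (ℓ α : ℝ) (Q : Potential ℓ) : ℝ :=
  α + ∫ x, (shootP ℓ α Q x ^ 2 - Q x * shootZ ℓ α Q x ^ 2) /
    (shootP ℓ α Q x ^ 2 + shootZ ℓ α Q x ^ 2) ∂(μI ℓ)

/-- The angle at `ℓ` is the end value of a continuous angle of `(z', z)` that starts from `α`. -/
lemma exists_prueferAngle_path (hℓ : 0 ≤ ℓ) (α : ℝ) (Q : Potential ℓ) :
    ∃ Θ : ℝ → ℝ, ContinuousOn Θ (Icc 0 ℓ) ∧ Θ 0 = α ∧ Θ ℓ = prueferAngle ℓ α Q ∧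
      ∀ x ∈ Icc 0 ℓ,
        shootP ℓ α Q x =
          Real.sqrt (shootP ℓ α Q x ^ 2 + shootZ ℓ α Q x ^ 2) * Real.cos (Θ x) ∧
        shootZ ℓ α Q x =
          Real.sqrt (shootP ℓ α Q x ^ 2 + shootZ ℓ α Q x ^ 2) * Real.sin (Θ x) := by
  have h := isSolPair_sol hℓ (Real.sin α) (Real.cos α) Q
  obtain ⟨Θ, h1, h2, -, h3, h4⟩ := exists_polar_angle hℓ h.snd h.fst
    (fun x hx => shoot_sq_pos hℓ α Q hx) (θ₀ := α) one_pos
    (by rw [one_mul, solP_zero hℓ]) (by rw [one_mul, solZ_zero hℓ])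
  refine ⟨Θ, h1, h2, ?_, h4⟩
  rw [h3, prueferAngle]
  congr 1
  refine integral_congr_ae (Eventually.of_forall fun x => ?_)
  simp only
  congr 1
  ring

lemma exists_shoot_right_eq (hℓ : 0 ≤ ℓ) (α : ℝ) (Q : Potential ℓ) :
    ∃ r > 0, shootP ℓ α Q ℓ = r * Real.cos (prueferAngle ℓ α Q) ∧
      shootZ ℓ α Q ℓ = r * Real.sin (prueferAngle ℓ α Q) := by
  obtain ⟨Θ, -, -, h3, h4⟩ := exists_prueferAngle_path hℓ α Q
  have hm := right_mem_Icc.2 hℓ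
  rw [← h3]
  exact ⟨_, Real.sqrt_pos.2 (shoot_sq_pos hℓ α Q hm), h4 ℓ hm⟩

lemma exists_bdry_eq (hℓ : 0 ≤ ℓ) (α γ : ℝ) (Q : Potential ℓ) :
    ∃ r > 0, bdry ℓ α γ Q = r * Real.sin (prueferAngle ℓ α Q - γ) := by
  obtain ⟨r, hr, h1, h2⟩ := exists_shoot_right_eq hℓ α Q
  refine ⟨r, hr, ?_⟩
  rw [bdry, h1, h2, Real.sin_sub]; ring

/-! ### Continuity and monotonicity of the Prüfer angle -/

lemma continuous_solZ_apply (hℓ : 0 ≤ ℓ) (a b x : ℝ) : Continuous fun Q => solZ ℓ a b Q x :=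
  (contDiff_eval x).continuous.comp (contDiff_solZ hℓ a b).continuous

lemma continuous_solP_apply (hℓ : 0 ≤ ℓ) (a b x : ℝ) : Continuous fun Q => solP ℓ a b Q x :=
  (contDiff_eval x).continuous.comp (contDiff_solP hℓ a b).continuous

/-- Continuity for the `L¹` norm. The integrand of the angle is `1 - u - Q u` with
`u = z² / (z'² + z²) ∈ [0, 1]`, and `u` depends continuously on `Q` at every point, so that dominated
convergence applies. -/
lemma continuous_prueferAngle (hℓ : 0 ≤ ℓ) (α : ℝ) : Continuous (prueferAngle ℓ α) := by
  set u : Potential ℓ → ℝ → ℝ := fun Q x =>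
    shootZ ℓ α Q x ^ 2 / (shootP ℓ α Q x ^ 2 + shootZ ℓ α Q x ^ 2) with hu
  have hu0 : ∀ Q x, 0 ≤ u Q x := fun Q x => by positivity
  have hu1 : ∀ Q x, u Q x ≤ 1 := fun Q x =>
    div_le_one_of_le₀ (by nlinarith [sq_nonneg (shootP ℓ α Q x)]) (by positivity)
  have hum : ∀ Q, Measurable (u Q) := fun Q => by
    have h1 := (shootZ ℓ α Q).continuous.measurable
    have h2 := (shootP ℓ α Q).continuous.measurable
    exact (h1.pow_const 2).div ((h2.pow_const 2).add (h1.pow_const 2))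
  have huc : ∀ x ∈ Icc 0 ℓ, Continuous fun Q => u Q x := fun x hx =>
    ((continuous_solZ_apply hℓ _ _ x).pow 2).div
      (((continuous_solP_apply hℓ _ _ x).pow 2).add ((continuous_solZ_apply hℓ _ _ x).pow 2))
      fun Q => (shoot_sq_pos hℓ α Q hx).ne'
  have hmem : ∀ᵐ x ∂(μI ℓ), x ∈ Icc 0 ℓ := ae_restrict_mem measurableSet_Icc
  have hbdd : ∀ (R Q : Potential ℓ), Integrable (fun x => R x * u Q x) (μI ℓ) := fun R Q =>
    (integrable_potential R).mul_bdd (c := 1) (hum Q).aestronglyMeasurable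
      (Eventually.of_forall fun x => by
        rw [Real.norm_eq_abs, abs_of_nonneg (hu0 Q x)]; exact hu1 Q x)
  have hui : ∀ Q, Integrable (u Q) (μI ℓ) := fun Q =>
    (hbdd (onePot ℓ) Q).congr (by
      filter_upwards [coeFn_onePot (ℓ := ℓ)] with t ht; rw [ht, one_mul])
  have hform : prueferAngle ℓ α = fun Q =>
      α + ((∫ x, (1 - u Q x) ∂(μI ℓ)) - ∫ x, Q x * u Q x ∂(μI ℓ)) := by
    funext Q
    have h1u : Integrable (fun x => 1 - u Q x) (μI ℓ) := (integrable_const 1).sub (hui Q)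
    rw [prueferAngle, ← integral_sub h1u (hbdd Q Q)]
    congr 1
    refine integral_congr_ae ?_
    filter_upwards [hmem] with x hx
    have := (shoot_sq_pos hℓ α Q hx).ne'
    simp only [hu]
    field_simp
    ring
  rw [hform]
  refine continuous_const.add (Continuous.sub ?_ ?_)
  · refine continuous_of_dominated (bound := fun _ => 1)
      (fun Q => (measurable_const.sub (hum Q)).aestronglyMeasurable) (fun Q => ?_)
      (integrable_const 1) ?_
    · refine Eventually.of_forall fun x => ?_
      rw [Real.norm_eq_abs, abs_of_nonneg (by linarith [hu1 Q x])]
      linarith [hu0 Q x]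
    · filter_upwards [hmem] with x hx using continuous_const.sub (huc x hx)
  · rw [continuous_iff_continuousAt]
    intro Q₀
    -- Split `∫ Q u_Q` into the same integral with `Q₀` for `Q`, and a remainder of size `‖Q - Q₀‖`.
    have hsplit : (fun Q : Potential ℓ => ∫ x, Q x * u Q x ∂(μI ℓ)) = fun Q =>
        (∫ x, Q₀ x * u Q x ∂(μI ℓ)) + ∫ x, (Q - Q₀ : Potential ℓ) x * u Q x ∂(μI ℓ) := by
      funext Q
      rw [← integral_add (hbdd _ _) (hbdd _ _)]
      refine integral_congr_ae ?_
      filter_upwards [Lp.coeFn_sub Q Q₀] with x hx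
      rw [hx, Pi.sub_apply]; ring
    have h1 : Continuous fun Q : Potential ℓ => ∫ x, Q₀ x * u Q x ∂(μI ℓ) := by
      refine continuous_of_dominated (bound := fun x => |Q₀ x|)
        (fun Q => (hbdd Q₀ Q).aestronglyMeasurable) (fun Q => ?_)
        (integrable_potential Q₀).abs ?_
      · refine Eventually.of_forall fun x => ?_
        rw [Real.norm_eq_abs, abs_mul, abs_of_nonneg (hu0 Q x)]
        exact mul_le_of_le_one_right (abs_nonneg _) (hu1 Q x)
      · filter_upwards [hmem] with x hx using continuous_const.mul (huc x hx)
    have h2 : Tendsto (fun Q : Potential ℓ => ∫ x, (Q - Q₀ : Potential ℓ) x * u Q x ∂(μI ℓ))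
        (𝓝 Q₀) (𝓝 0) := by
      have hlim : Tendsto (fun Q : Potential ℓ => ‖Q - Q₀‖) (𝓝 Q₀) (𝓝 0) := by
        have : Continuous fun Q : Potential ℓ => ‖Q - Q₀‖ := by fun_prop
        simpa using this.tendsto Q₀
      refine squeeze_zero_norm (fun Q => ?_) hlim
      rw [norm_potential]
      refine norm_integral_le_of_norm_le (integrable_potential _).abs
        (Eventually.of_forall fun x => ?_)
      rw [Real.norm_eq_abs, abs_mul, abs_of_nonneg (hu0 Q x)]
      exact mul_le_of_le_one_right (abs_nonneg _) (hu1 Q x)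
    have h20 : ∫ x, (Q₀ - Q₀ : Potential ℓ) x * u Q₀ x ∂(μI ℓ) = 0 := by
      rw [sub_self, integral_eq_zero_of_ae]
      filter_upwards [Lp.coeFn_zero ℝ 1 (μI ℓ)] with x hx
      rw [hx]; simp
    rw [hsplit]
    refine h1.continuousAt.add ?_
    rw [ContinuousAt, h20]
    exact h2

/-- A continuous function that exceeds its value at each point immediately to the right of that
point is strictly increasing. -/
lemma strictMono_of_eventually_gt {f : ℝ → ℝ} (hf : Continuous f)
    (h : ∀ x, ∀ᶠ y in 𝓝[>] x, f x < f y) : StrictMono f := by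
  have hmono : Monotone f := by
    intro a b hab
    have hsub : Icc a b ⊆ {y | f a ≤ f y} := by
      refine IsClosed.Icc_subset_of_forall_exists_gt ?_ (le_refl (f a)) ?_
      · exact (isClosed_le continuous_const hf).inter isClosed_Icc
      · intro x hx y hy
        obtain ⟨t, ht1, ht2⟩ := ((h x).and (Ioc_mem_nhdsGT hy)).exists
        exact ⟨t, le_trans hx.1 ht1.le, ht2⟩
    exact hsub (right_mem_Icc.2 hab)
  intro a b hab
  obtain ⟨t, ht1, ht2⟩ := ((h a).and (Ioc_mem_nhdsGT hab)).exists
  exact ht1.trans_le (hmono ht2.2)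

lemma continuous_sub_smul_onePot (q : Potential ℓ) :
    Continuous fun t : ℝ => (q - t • onePot ℓ : Potential ℓ) := by fun_prop

/-- The derivative of the boundary function in the spectral parameter. -/
lemma hasDerivAt_bdry_sub_smul (hℓ : 0 ≤ ℓ) (α γ : ℝ) (q : Potential ℓ) (t : ℝ) :
    HasDerivAt (fun t : ℝ => bdry ℓ α γ (q - t • onePot ℓ))
      (-fderiv ℝ (bdry ℓ α γ) (q - t • onePot ℓ) (onePot ℓ)) t := by
  have h1 : HasDerivAt (fun t : ℝ => (q - t • onePot ℓ : Potential ℓ)) (-onePot ℓ) t := by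
    simpa using ((hasDerivAt_id t).smul_const (onePot ℓ)).const_sub q
  have h2 := (hasFDerivAt_bdry hℓ α γ (q - t • onePot ℓ)).comp_hasDerivAt t h1
  rw [map_neg] at h2
  exact h2

lemma strictMono_prueferAngle (hℓ : 0 < ℓ) (α : ℝ) (q : Potential ℓ) :
    StrictMono fun t : ℝ => prueferAngle ℓ α (q - t • onePot ℓ) := by
  have hcont : Continuous fun t : ℝ => prueferAngle ℓ α (q - t • onePot ℓ) :=
    (continuous_prueferAngle hℓ.le α).comp (continuous_sub_smul_onePot q)
  refine strictMono_of_eventually_gt hcont fun t₀ => ?_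
  set γ := prueferAngle ℓ α (q - t₀ • onePot ℓ) with hγ
  -- With this choice of `γ` the boundary function vanishes at `t₀`; its derivative is positive.
  obtain ⟨r, hr, h1, h2⟩ := exists_shoot_right_eq hℓ.le α (q - t₀ • onePot ℓ)
  rw [← hγ] at h1 h2
  have h0 : bdry ℓ α γ (q - t₀ • onePot ℓ) = 0 := by rw [bdry, h1, h2]; ring
  have hd := hasDerivAt_bdry_sub_smul hℓ.le α γ q t₀
  have hder : 0 < -fderiv ℝ (bdry ℓ α γ) (q - t₀ • onePot ℓ) (onePot ℓ) := by
    have h3 := fderiv_bdry_of_eq_zero hℓ.le h0 (onePot ℓ)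
    have h4 := weight_onePot_pos hℓ (sin_ne_zero_or_cos_ne_zero α) (q - t₀ • onePot ℓ)
    rw [h1, h2] at h3
    have h5 : r * Real.sin γ * Real.sin γ + r * Real.cos γ * Real.cos γ = r := by
      linear_combination r * Real.sin_sq_add_cos_sq γ
    rw [h5] at h3
    refine (mul_pos_iff_of_pos_left hr).1 ?_
    linarith
  have hslope := (hasDerivAt_iff_tendsto_slope.1 hd).eventually_const_lt hder
  have hslope' := hslope.filter_mono (nhdsWithin_mono t₀ (fun y (hy : t₀ < y) => hy.ne'))
  have hnear : ∀ᶠ t in 𝓝[>] t₀, |prueferAngle ℓ α (q - t • onePot ℓ) - γ| < Real.pi := by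
    have hc : Continuous fun t : ℝ => |prueferAngle ℓ α (q - t • onePot ℓ) - γ| :=
      (hcont.sub continuous_const).abs
    have := hc.tendsto t₀
    rw [← hγ, sub_self, abs_zero] at this
    exact (this.eventually_lt_const Real.pi_pos).filter_mono nhdsWithin_le_nhds
  filter_upwards [hslope', hnear, self_mem_nhdsWithin] with t ht1 ht2 ht3
  obtain ⟨r', hr', hb⟩ := exists_bdry_eq hℓ.le α γ (q - t • onePot ℓ)
  rw [slope_def_field, h0, sub_zero, hb] at ht1
  have hsin : 0 < Real.sin (prueferAngle ℓ α (q - t • onePot ℓ) - γ) := by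
    have h6 : 0 < t - t₀ := sub_pos.2 ht3
    have h7 := (div_pos_iff_of_pos_right h6).1 ht1
    exact (mul_pos_iff_of_pos_left hr').1 h7
  by_contra hcon
  have h8 : prueferAngle ℓ α (q - t • onePot ℓ) - γ ≤ 0 := by linarith [not_lt.1 hcon]
  have h9 := Real.sin_nonpos_of_nonpos_of_neg_pi_le h8 (by linarith [(abs_lt.1 ht2).1])
  linarith

/-! ### Range of the Prüfer angle -/

lemma mem_Ioo_of_continuousOn {f : ℝ → ℝ} {a b u v : ℝ} (hab : a ≤ b)
    (hf : ContinuousOn f (Icc a b)) (ha : f a ∈ Ioo u v) (hu : ∀ x ∈ Icc a b, f x ≠ u)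
    (hv : ∀ x ∈ Icc a b, f x ≠ v) : f b ∈ Ioo u v := by
  have hma := left_mem_Icc.2 hab
  have hmb := right_mem_Icc.2 hab
  constructor
  · by_contra! h
    obtain ⟨x, hx, hx'⟩ := isPreconnected_Icc.intermediate_value hmb hma hf ⟨h, ha.1.le⟩
    exact hu x hx hx'
  · by_contra! h
    obtain ⟨x, hx, hx'⟩ := isPreconnected_Icc.intermediate_value hma hmb hf ⟨ha.2.le, h⟩
    exact hv x hx hx'

lemma cos_nonpos_of_pi_div_two_le_abs {x : ℝ} (h1 : Real.pi / 2 ≤ |x|) (h2 : |x| ≤ Real.pi) :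
    Real.cos x ≤ 0 := by
  rw [← Real.cos_abs]
  exact Real.cos_nonpos_of_pi_div_two_le_of_le h1 (by linarith [Real.pi_pos])

/-- The angle of the vector `(cos α, k sin α)` lies in the same quadrant as `α`. -/
lemma exists_scaled_angle {α k : ℝ} (hα : α ∈ Ico 0 Real.pi) (hk : 0 < k) :
    ∃ r φ : ℝ, 0 < r ∧ 0 ≤ φ ∧ |φ - α| < Real.pi / 2 ∧ Real.cos α = r * Real.cos φ ∧
      k * Real.sin α = r * Real.sin φ := by
  have hs : 0 ≤ Real.sin α := Real.sin_nonneg_of_nonneg_of_le_pi hα.1 hα.2.le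
  have hpos : 0 < Real.cos α ^ 2 + k * Real.sin α ^ 2 := by
    rcases eq_or_ne (Real.sin α) 0 with h | h
    · have := Real.sin_sq_add_cos_sq α
      rw [h] at this ⊢
      nlinarith
    · positivity
  set w : ℂ := ⟨Real.cos α, k * Real.sin α⟩ with hw
  have hre : ‖w‖ * Real.cos w.arg = Real.cos α := Complex.norm_mul_cos_arg w
  have him : ‖w‖ * Real.sin w.arg = k * Real.sin α := Complex.norm_mul_sin_arg w
  have hr : 0 < ‖w‖ := by
    rw [norm_pos_iff]
    intro h0
    rw [h0] at hre him
    simp only [norm_zero, zero_mul] at hre him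
    have : Real.sin α = 0 := by
      rcases mul_eq_zero.1 him.symm with h | h
      · exact absurd h hk.ne'
      · exact h
    rw [← hre, this] at hpos
    norm_num at hpos
  have harg : 0 ≤ w.arg := Complex.arg_nonneg_iff.2 (mul_nonneg hk.le hs)
  refine ⟨‖w‖, w.arg, hr, harg, ?_, hre.symm, him.symm⟩
  by_contra! hcon
  have hle : |w.arg - α| ≤ Real.pi := by
    rw [abs_le]
    constructor <;> linarith [Complex.arg_le_pi w, hα.1, hα.2]
  have hcos := cos_nonpos_of_pi_div_two_le_abs hcon hle
  rw [Real.cos_sub] at hcos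
  have : ‖w‖ * (Real.cos w.arg * Real.cos α + Real.sin w.arg * Real.sin α) =
      Real.cos α ^ 2 + k * Real.sin α ^ 2 := by
    linear_combination Real.cos α * hre + Real.sin α * him
  nlinarith

/-- The Prüfer angle is unbounded as the spectral parameter tends to infinity: for `λ = k²` the
angle of `(z', k z)` grows at rate at least `k - |q|`, and it differs from the angle of `(z', z)` by
less than `π / 2`. -/
lemma exists_lt_prueferAngle (hℓ : 0 < ℓ) {α : ℝ} (hα : α ∈ Ico 0 Real.pi) (q : Potential ℓ)
    (B : ℝ) : ∃ t : ℝ, B < prueferAngle ℓ α (q - t • onePot ℓ) := by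
  set k : ℝ := 1 + (|B| + ‖q‖ + Real.pi) / ℓ with hk
  have hk1 : 1 ≤ k := by
    have : 0 ≤ (|B| + ‖q‖ + Real.pi) / ℓ := by positivity
    linarith
  have hk0 : 0 < k := by linarith
  have hkℓ : k * ℓ = ℓ + (|B| + ‖q‖ + Real.pi) := by rw [hk]; field_simp
  refine ⟨k ^ 2, ?_⟩
  set Q : Potential ℓ := q - k ^ 2 • onePot ℓ with hQ
  have hsol := isSolPair_sol hℓ.le (Real.sin α) (Real.cos α) Q
  have hsq := fun x (hx : x ∈ Icc 0 ℓ) => shoot_sq_pos hℓ.le α Q hx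
  have hsqk : ∀ x ∈ Icc 0 ℓ, 0 < shootP ℓ α Q x ^ 2 + (k * shootZ ℓ α Q x) ^ 2 := by
    intro x hx
    nlinarith [hsq x hx, mul_nonneg (mul_nonneg (sub_nonneg.2 hk1) (by linarith : 0 ≤ k + 1))
      (sq_nonneg (shootZ ℓ α Q x))]
  obtain ⟨r, φ₀, hr, hφ₀, hclose, hc, hs⟩ := exists_scaled_angle hα hk0
  obtain ⟨Φ, hΦc, hΦ0, hΦi, hΦℓ, hΦ⟩ := exists_polar_angle hℓ.le hsol.snd (hsol.fst.const_mul k) hsqk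
    hr (θ₀ := φ₀) (by rw [solP_zero hℓ.le, hc]) (by rw [solZ_zero hℓ.le, hs])
  obtain ⟨Θ, hΘc, hΘ0, hΘℓ, hΘ⟩ := exists_prueferAngle_path hℓ.le α Q
  have hlow : k * ℓ - ‖q‖ ≤ Φ ℓ - φ₀ := by
    rw [hΦℓ, add_sub_cancel_left]
    have h1 : Integrable (fun x => k - |q x|) (μI ℓ) :=
      (integrable_const k).sub (integrable_potential q).abs
    have h2 : ∫ x, (k - |q x|) ∂(μI ℓ) = k * ℓ - ‖q‖ := by
      rw [integral_sub (integrable_const k) (integrable_potential q).abs, norm_potential]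
      simp [measureReal_def, hℓ.le, mul_comm]
    rw [← h2]
    refine integral_mono_ae h1 hΦi ?_
    filter_upwards [coeFn_sub_smul_onePot q (k ^ 2), ae_muI_mem_Ioo (ℓ := ℓ)] with x hx hmem
    have hpos := hsqk x ⟨hmem.1.le, hmem.2.le⟩
    simp only [sub_zero]
    rw [hx, le_div_iff₀ hpos]
    set z := shootZ ℓ α Q x
    set p := shootP ℓ α Q x
    have e1 : q x * z ^ 2 * k ≤ |q x| * (p ^ 2 + (k * z) ^ 2) := by
      have h3 : q x * (z ^ 2 * k) ≤ |q x| * (z ^ 2 * k) :=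
        mul_le_mul_of_nonneg_right (le_abs_self _) (by positivity)
      have h4 : z ^ 2 * k ≤ p ^ 2 + (k * z) ^ 2 := by
        nlinarith [sq_nonneg p, mul_nonneg (mul_nonneg hk0.le (sub_nonneg.2 hk1)) (sq_nonneg z)]
      have h5 := mul_le_mul_of_nonneg_left h4 (abs_nonneg (q x))
      linarith
    nlinarith
  have hcos : ∀ x ∈ Icc 0 ℓ, 0 < Real.cos (Φ x - Θ x) := by
    intro x hx
    have h1 := hΦ x hx
    have h2 := hΘ x hx
    have hR := Real.sqrt_pos.2 (hsqk x hx)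
    have hS := Real.sqrt_pos.2 (hsq x hx)
    set R := Real.sqrt (shootP ℓ α Q x ^ 2 + (k * shootZ ℓ α Q x) ^ 2)
    set S := Real.sqrt (shootP ℓ α Q x ^ 2 + shootZ ℓ α Q x ^ 2)
    have h3 : (R * S) * Real.cos (Φ x - Θ x) = shootP ℓ α Q x ^ 2 + k * shootZ ℓ α Q x ^ 2 := by
      have e1 : shootP ℓ α Q x ^ 2 = (R * Real.cos (Φ x)) * (S * Real.cos (Θ x)) := by
        rw [← h1.1, ← h2.1]; ring
      have e2 : k * shootZ ℓ α Q x ^ 2 = (R * Real.sin (Φ x)) * (S * Real.sin (Θ x)) := by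
        rw [← h1.2, ← h2.2]; ring
      rw [e1, e2, Real.cos_sub]; ring
    have h4 : 0 < shootP ℓ α Q x ^ 2 + k * shootZ ℓ α Q x ^ 2 := by
      nlinarith [hsq x hx, mul_nonneg (sub_nonneg.2 hk1) (sq_nonneg (shootZ ℓ α Q x))]
    rw [← h3] at h4
    exact (mul_pos_iff_of_pos_left (mul_pos hR hS)).1 h4
  have hmem : Φ ℓ - Θ ℓ ∈ Ioo (-(Real.pi / 2)) (Real.pi / 2) := by
    refine mem_Ioo_of_continuousOn (f := fun x => Φ x - Θ x) hℓ.le (hΦc.sub hΘc) ?_ ?_ ?_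
    · simp only [hΦ0, hΘ0]; exact abs_lt.1 hclose
    · intro x hx h
      have := hcos x hx
      rw [h, Real.cos_neg, Real.cos_pi_div_two] at this
      exact lt_irrefl _ this
    · intro x hx h
      have := hcos x hx
      rw [h, Real.cos_pi_div_two] at this
      exact lt_irrefl _ this
  rw [← hΘℓ]
  have h1 := hmem.2
  have h2 := le_abs_self B
  have h3 := Real.pi_pos
  linarith

/-- For a very negative spectral parameter the solution is positive on `(0, ℓ]` and its logarithmic
derivative at `ℓ` is large: in the cone `{z ≥ 0, z' ≥ m z}`, where `m = -K + s x + ∫₀ˣ q` and `s` is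
so chosen that `m` rises by `2 K`, the system for `(z, z' - m z)` is cooperative. -/
lemma exists_forall_shoot_pos (hℓ : 0 < ℓ) {α β : ℝ} (hα : α ∈ Ico 0 Real.pi)
    (hβ : β ∈ Ioc 0 Real.pi) (q : Potential ℓ) :
    ∃ t₀ : ℝ, ∀ t ≤ t₀, (∀ x ∈ Ioc 0 ℓ, 0 < shootZ ℓ α (q - t • onePot ℓ) x) ∧
      bdry ℓ α β (q - t • onePot ℓ) < 0 := by
  set K : ℝ := ‖q‖ + |Real.cos α| / Real.sin α + |Real.cos β| / Real.sin β + 1 with hK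
  have hsα : 0 ≤ Real.sin α := Real.sin_nonneg_of_nonneg_of_le_pi hα.1 hα.2.le
  have hsβ : 0 ≤ Real.sin β := Real.sin_nonneg_of_nonneg_of_le_pi hβ.1.le hβ.2
  have hKα : 0 ≤ |Real.cos α| / Real.sin α := by positivity
  have hKβ : 0 ≤ |Real.cos β| / Real.sin β := by positivity
  have hK0 : 0 < K := by positivity
  set s : ℝ := 2 * K / ℓ with hs
  have hs0 : 0 < s := by positivity
  have hsℓ : s * ℓ = 2 * K := by rw [hs]; field_simp
  refine ⟨-s - (‖q‖ + K) ^ 2, fun t ht => ?_⟩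
  set Q : Potential ℓ := q - t • onePot ℓ with hQ
  have hsol := isSolPair_sol hℓ.le (Real.sin α) (Real.cos α) Q
  set z := shootZ ℓ α Q with hz
  set p := shootP ℓ α Q with hp
  have hqs : Integrable (fun x => q x + s) (μI ℓ) := (integrable_potential q).add (integrable_const s)
  have hm := hasACDeriv_integral hℓ.le hqs (-K)
  set m : ℝ → ℝ := fun x => -K + ∫ y in (0 : ℝ)..x, (q y + s) with hmdef
  have hm_eq : ∀ x ∈ Icc 0 ℓ, m x = -K + s * x + volterra ℓ q 1 x := by
    intro x hx
    have h0 := left_mem_Icc.2 hℓ.le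
    rw [volterra_apply_of_mem _ _ hx, hmdef]
    simp only
    rw [intervalIntegral.integral_add
      (intervalIntegrable_of_integrable (integrable_potential q) h0 hx)
      (intervalIntegrable_of_integrable (integrable_const s) h0 hx)]
    simp; ring
  have hV : ∀ x, |volterra ℓ q 1 x| ≤ ‖q‖ := fun x => by
    simpa using abs_volterra_le q 1 (x := x) (B := 1) (by simp) zero_le_one
  have hm_abs : ∀ x ∈ Icc 0 ℓ, |m x| ≤ ‖q‖ + K := by
    intro x hx
    have h1 := abs_le.1 (hV x)
    have h2 : s * x ≤ s * ℓ := mul_le_mul_of_nonneg_left hx.2 hs0.le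
    have h3 : 0 ≤ s * x := mul_nonneg hs0.le hx.1
    rw [hm_eq x hx, abs_le]
    constructor <;> linarith
  have hmi : Integrable m (μI ℓ) := hm.continuousOn.integrableOn_Icc
  have hI := hasACDeriv_integral hℓ.le hmi 0
  set I : ℝ → ℝ := fun x => 0 + ∫ y in (0 : ℝ)..x, m y with hIdef
  set u : ℝ → ℝ := fun x => p x - m x * z x with hu
  -- The pair `(z, u)` solves `z' = m z + u`, `u' = A z - m u` with `A = -t - s - m² ≥ 0`.
  have hu_ac := hsol.snd.sub (hm.mul hsol.fst)
  have hZ : HasACDeriv ℓ (fun x => z x * Real.exp (-1 * I x)) (fun x => u x * Real.exp (-1 * I x)) :=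
    (hsol.fst.mul (hI.const_mul (-1)).exp).congr_deriv (Eventually.of_forall fun x => by
      simp only [hu]; ring)
  have hY : HasACDeriv ℓ (fun x => u x * Real.exp (I x))
      (fun x => (-t - s - m x ^ 2) * z x * Real.exp (I x)) :=
    (hu_ac.mul hI.exp).congr_deriv (by
      filter_upwards [coeFn_sub_smul_onePot q t] with x hx
      rw [hx]
      ring)
  have hz0 : z 0 = Real.sin α := solZ_zero hℓ.le _ _ _
  have hp0 : p 0 = Real.cos α := solP_zero hℓ.le _ _ _
  have hm0 : m 0 = -K := by simp [hmdef]
  have hu0 : 0 < u 0 := by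
    simp only [hu, hz0, hp0, hm0]
    rcases hsα.eq_or_lt with h | h
    · have h1 : α = 0 := by
        by_contra h2
        have := Real.sin_pos_of_pos_of_lt_pi (lt_of_le_of_ne hα.1 (Ne.symm h2)) hα.2
        linarith
      rw [h1]; simp
    · have h1 : |Real.cos α| / Real.sin α * Real.sin α = |Real.cos α| := div_mul_cancel₀ _ h.ne'
      have h2 : |Real.cos α| / Real.sin α < K := by
        rw [hK]; linarith [norm_nonneg q]
      have h3 := mul_lt_mul_of_pos_right h2 h
      linarith [neg_abs_le (Real.cos α)]
  have huc : ContinuousOn u (Icc 0 ℓ) := hu_ac.continuousOn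
  have hupos : ∀ x ∈ Icc 0 ℓ, 0 < u x := by
    by_contra! hcon
    obtain ⟨x₀, hx₀, hux₀⟩ := hcon
    -- `b` is the first point where `u ≤ 0`.
    have hcpt : IsCompact (Icc 0 ℓ ∩ u ⁻¹' Iic 0) :=
      (huc.preimage_isClosed_of_isClosed isClosed_Icc isClosed_Iic) |>
        fun h => isCompact_Icc.of_isClosed_subset h inter_subset_left
    obtain ⟨b, hb, hmin⟩ := hcpt.exists_isLeast ⟨x₀, hx₀, hux₀⟩
    have hlt : ∀ x ∈ Icc 0 ℓ, x < b → 0 < u x := by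
      intro x hx hxb
      by_contra! h
      exact absurd (hmin ⟨hx, h⟩) (not_le.2 hxb)
    have hzb : ∀ x ∈ Icc 0 b, 0 ≤ z x := by
      intro x hx
      have h1 := hZ.monotoneOn (b := b) hb.1.2 (by
        filter_upwards [ae_muI_mem_Ioo (ℓ := ℓ)] with y hy hyb
        exact mul_nonneg (hlt y ⟨hy.1.le, hy.2.le⟩ hyb).le (Real.exp_pos _).le) x hx
      have h2 : 0 ≤ z x * Real.exp (-1 * I x) :=
        le_trans (mul_nonneg (by rw [hz0]; exact hsα) (Real.exp_pos _).le) h1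
      exact nonneg_of_mul_nonneg_left h2 (Real.exp_pos _)
    have h3 := hY.monotoneOn (b := b) hb.1.2 (by
      filter_upwards [ae_muI_mem_Ioo (ℓ := ℓ)] with y hy hyb
      refine mul_nonneg (mul_nonneg ?_ (hzb y ⟨hy.1.le, hyb.le⟩)) (Real.exp_pos _).le
      have := sq_le_sq' (abs_le.1 (hm_abs y ⟨hy.1.le, hy.2.le⟩)).1
        (abs_le.1 (hm_abs y ⟨hy.1.le, hy.2.le⟩)).2
      linarith) b ⟨hb.1.1, le_rfl⟩
    have h4 : u b * Real.exp (I b) ≤ 0 :=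
      mul_nonpos_of_nonpos_of_nonneg hb.2 (Real.exp_pos _).le
    have h5 : 0 < u 0 * Real.exp (I 0) := mul_pos hu0 (Real.exp_pos _)
    linarith
  have hzpos : ∀ x ∈ Ioc 0 ℓ, 0 < z x := by
    intro x hx
    have h1 := hZ.integral_eq_sub le_rfl hx.1.le hx.2
    have h2 : 0 < ∫ y in (0 : ℝ)..x, u y * Real.exp (-1 * I y) := by
      refine intervalIntegral.intervalIntegral_pos_of_pos_on ?_ (fun y hy => ?_) hx.1
      · exact intervalIntegrable_of_integrable (hZ.integrable hℓ.le) (left_mem_Icc.2 hℓ.le)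
          ⟨hx.1.le, hx.2⟩
      · exact mul_pos (hupos y ⟨hy.1.le, hy.2.le.trans hx.2⟩) (Real.exp_pos _)
    have h3 : 0 ≤ z 0 * Real.exp (-1 * I 0) :=
      mul_nonneg (by rw [hz0]; exact hsα) (Real.exp_pos _).le
    have h4 : 0 < z x * Real.exp (-1 * I x) := by linarith
    exact (mul_pos_iff_of_pos_right (Real.exp_pos _)).1 h4
  refine ⟨hzpos, ?_⟩
  have hmℓ := right_mem_Icc.2 hℓ.le
  have hzℓ := hzpos ℓ ⟨hℓ, le_rfl⟩
  rw [bdry, ← hz, ← hp]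
  rcases hsβ.eq_or_lt with h | h
  · have h1 : β = Real.pi := by
      by_contra h2
      have := Real.sin_pos_of_pos_of_lt_pi hβ.1 (lt_of_le_of_ne hβ.2 h2)
      linarith
    rw [h1]; simpa using hzℓ
  · have h1 := hupos ℓ hmℓ
    simp only [hu] at h1
    have h2 : |Real.cos β| / Real.sin β ≤ m ℓ := by
      rw [hm_eq ℓ hmℓ, hsℓ]
      have := abs_le.1 (hV ℓ)
      linarith
    have h3 : |Real.cos β| / Real.sin β * Real.sin β = |Real.cos β| := div_mul_cancel₀ _ h.ne'
    have h4 : |Real.cos β| ≤ m ℓ * Real.sin β := by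
      rw [← h3]; exact mul_le_mul_of_nonneg_right h2 h.le
    have h5 : z ℓ * Real.cos β ≤ z ℓ * (m ℓ * Real.sin β) :=
      mul_le_mul_of_nonneg_left ((le_abs_self _).trans h4) hzℓ.le
    have h6 : m ℓ * z ℓ * Real.sin β < p ℓ * Real.sin β :=
      mul_lt_mul_of_pos_right (by linarith) h
    linarith

lemma mem_Ioo_of_sin_pos {Θ : ℝ → ℝ} (hℓ : 0 < ℓ) (hc : ContinuousOn Θ (Icc 0 ℓ))
    (h0 : Θ 0 ∈ Ico 0 Real.pi) (hsin : ∀ x ∈ Ioc 0 ℓ, 0 < Real.sin (Θ x)) :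
    Θ ℓ ∈ Ioo 0 Real.pi := by
  -- Near `0` the values are in `(-π, π)`, where a positive sine forces a positive angle.
  have hev : ∀ᶠ x in 𝓝[Icc 0 ℓ] 0, Θ x ∈ Ioo (-Real.pi) Real.pi :=
    (hc 0 (left_mem_Icc.2 hℓ.le)).eventually
      (Ioo_mem_nhds (by linarith [Real.pi_pos, h0.1]) h0.2)
  have hev' : ∀ᶠ x in 𝓝[>] (0 : ℝ), Θ x ∈ Ioo (-Real.pi) Real.pi := by
    rw [← nhdsWithin_Ioc_eq_nhdsGT hℓ]
    exact hev.filter_mono (nhdsWithin_mono 0 Ioc_subset_Icc_self)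
  obtain ⟨a, ha, haℓ⟩ := (hev'.and (Ioc_mem_nhdsGT hℓ)).exists
  have hasin := hsin a haℓ
  have hapos : 0 < Θ a := by
    by_contra! h
    have := Real.sin_nonpos_of_nonpos_of_neg_pi_le h ha.1.le
    linarith
  refine mem_Ioo_of_continuousOn haℓ.2 (hc.mono (Icc_subset_Icc_left haℓ.1.le)) ⟨hapos, ha.2⟩ ?_ ?_
  · intro x hx h
    have := hsin x ⟨haℓ.1.trans_le hx.1, hx.2⟩
    rw [h, Real.sin_zero] at this
    exact lt_irrefl _ this
  · intro x hx h
    have := hsin x ⟨haℓ.1.trans_le hx.1, hx.2⟩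
    rw [h, Real.sin_pi] at this
    exact lt_irrefl _ this

lemma exists_forall_prueferAngle_mem (hℓ : 0 < ℓ) {α β : ℝ} (hα : α ∈ Ico 0 Real.pi)
    (hβ : β ∈ Ioc 0 Real.pi) (q : Potential ℓ) :
    ∃ t₀ : ℝ, ∀ t ≤ t₀, prueferAngle ℓ α (q - t • onePot ℓ) ∈ Ioo 0 β := by
  obtain ⟨t₀, h⟩ := exists_forall_shoot_pos hℓ hα hβ q
  refine ⟨t₀, fun t ht => ?_⟩
  obtain ⟨hz, hb⟩ := h t ht
  obtain ⟨Θ, hc, h0, hend, hpolar⟩ := exists_prueferAngle_path hℓ.le α (q - t • onePot ℓ)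
  have hmem : Θ ℓ ∈ Ioo 0 Real.pi := by
    refine mem_Ioo_of_sin_pos hℓ hc (by rw [h0]; exact hα) fun x hx => ?_
    have h1 := hz x hx
    rw [(hpolar x ⟨hx.1.le, hx.2⟩).2] at h1
    exact (mul_pos_iff_of_pos_left
      (Real.sqrt_pos.2 (shoot_sq_pos hℓ.le α _ ⟨hx.1.le, hx.2⟩))).1 h1
  rw [hend] at hmem
  refine ⟨hmem.1, ?_⟩
  obtain ⟨r, hr, hbr⟩ := exists_bdry_eq hℓ.le α β (q - t • onePot ℓ)
  rw [hbr] at hb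
  by_contra! hcon
  have h2 := Real.sin_nonneg_of_nonneg_of_le_pi (sub_nonneg.2 hcon) (by linarith [hmem.2, hβ.1])
  have := mul_nonneg hr.le h2
  linarith

lemma prueferAngle_pos (hℓ : 0 < ℓ) {α : ℝ} (hα : α ∈ Ico 0 Real.pi) (q : Potential ℓ) (t : ℝ) :
    0 < prueferAngle ℓ α (q - t • onePot ℓ) := by
  obtain ⟨t₀, h⟩ := exists_forall_prueferAngle_mem hℓ hα (right_mem_Ioc.2 Real.pi_pos) q
  have h1 := (h (min t t₀) (min_le_right _ _)).1
  exact h1.trans_le ((strictMono_prueferAngle hℓ α q).monotone (min_le_left _ _))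

/-! ### Eigenvalues as level sets of the Prüfer angle -/

lemma IsSolPair.eqOn_snd (hℓ : 0 < ℓ) {Q Q' f f' z p w r : ℝ → ℝ} (hz : IsSolPair ℓ Q f z p)
    (hw : IsSolPair ℓ Q' f' w r) (h : EqOn z w (Icc 0 ℓ)) : EqOn p r (Icc 0 ℓ) := by
  intro x hx
  have h1 := (hw.hasDerivWithinAt hx).congr_of_mem h hx
  exact (uniqueDiffOn_Icc hℓ x hx).eq_deriv _ (hz.hasDerivWithinAt hx) h1

lemma exists_solZ_ne_zero (hℓ : 0 < ℓ) {a b : ℝ} (hab : a ≠ 0 ∨ b ≠ 0) (Q : Potential ℓ) :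
    ∃ x ∈ Icc 0 ℓ, solZ ℓ a b Q x ≠ 0 := by
  by_contra! hcon
  have h := weight_onePot_pos hℓ hab Q
  rw [weight_onePot, setIntegral_congr_fun (g := fun _ => 0) measurableSet_Icc] at h
  · simp at h
  · intro x hx
    simp only [hcon x hx, mul_zero]

lemma solvesBVP_const_mul_shoot (hℓ : 0 < ℓ) {α β t : ℝ} {q : Potential ℓ}
    (h : bdry ℓ α β (q - t • onePot ℓ) = 0) (c : ℝ) :
    SolvesBVP ℓ α β q t (fun x => c * shootZ ℓ α (q - t • onePot ℓ) x) := by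
  have hsol := ((isSolPair_sol hℓ.le (Real.sin α) (Real.cos α) (q - t • onePot ℓ)).const_mul c)
  have hq : IsSolPair ℓ (fun x => q x - t) (fun _ => 0)
      (fun x => c * shootZ ℓ α (q - t • onePot ℓ) x)
      (fun x => c * shootP ℓ α (q - t • onePot ℓ) x) := hsol.congr_ae (by
    filter_upwards [coeFn_sub_smul_onePot q t] with x hx; rw [hx, mul_zero])
  refine ⟨hq.isSolution hℓ, ?_, ?_⟩
  · rw [hq.dI_eqOn hℓ (left_mem_Icc.2 hℓ.le)]
    simp only [solZ_zero hℓ.le, solP_zero hℓ.le]; ring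
  · rw [hq.dI_eqOn hℓ (right_mem_Icc.2 hℓ.le)]
    rw [bdry] at h
    linear_combination c * h

/-- Every solution of the boundary value problem is a multiple of the shooting solution, and if
it is not trivial then the boundary function vanishes. -/
lemma SolvesBVP.eqOn_shoot (hℓ : 0 < ℓ) {α β t : ℝ} {q : Potential ℓ} {z : ℝ → ℝ}
    (h : SolvesBVP ℓ α β q t z) :
    ∃ c : ℝ, EqOn z (fun x => c * shootZ ℓ α (q - t • onePot ℓ) x) (Icc 0 ℓ) ∧
      c * bdry ℓ α β (q - t • onePot ℓ) = 0 := by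
  obtain ⟨hs, h0, h1⟩ := h
  have hz : IsSolPair ℓ (q - t • onePot ℓ : Potential ℓ) (fun _ => 0) z (dI ℓ z) :=
    (hs.isSolPair hℓ).congr_ae (by
      filter_upwards [coeFn_sub_smul_onePot q t] with x hx; rw [hx])
  set c := z 0 * Real.sin α + dI ℓ z 0 * Real.cos α with hc
  have hsol : IsSolPair ℓ (q - t • onePot ℓ : Potential ℓ) (fun _ => 0)
      (fun x => c * shootZ ℓ α (q - t • onePot ℓ) x)
      (fun x => c * shootP ℓ α (q - t • onePot ℓ) x) :=
    ((isSolPair_sol hℓ.le _ _ _).const_mul c).congr_ae (by simp)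
  have hsc := Real.sin_sq_add_cos_sq α
  have heq := hz.eqOn _ hsol
    (by rw [solZ_zero hℓ.le, hc]; linear_combination Real.cos α * h0 - z 0 * hsc)
    (by rw [solP_zero hℓ.le, hc]; linear_combination -Real.sin α * h0 - dI ℓ z 0 * hsc)
  refine ⟨c, heq, ?_⟩
  have hm := right_mem_Icc.2 hℓ.le
  have h2 := heq hm
  have h3 := hz.eqOn_snd hℓ hsol heq hm
  simp only at h2 h3
  rw [h2, h3] at h1
  rw [bdry]; linear_combination h1

lemma mem_eigenvalues_iff (hℓ : 0 < ℓ) {α β t : ℝ} {q : Potential ℓ} :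
    t ∈ eigenvalues ℓ α β q ↔ bdry ℓ α β (q - t • onePot ℓ) = 0 := by
  constructor
  · rintro ⟨z, hz, x, hx, hne⟩
    obtain ⟨c, hc, h0⟩ := hz.eqOn_shoot hℓ
    rcases mul_eq_zero.1 h0 with h | h
    · exact absurd (by rw [hc hx, h]; exact zero_mul _) hne
    · exact h
  · intro h
    obtain ⟨x, hx, hne⟩ :=
      exists_solZ_ne_zero hℓ (sin_ne_zero_or_cos_ne_zero α) (q - t • onePot ℓ)
    exact ⟨_, solvesBVP_const_mul_shoot hℓ h 1, x, hx, by rwa [one_mul]⟩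

lemma mem_eigenvalues_iff_angle (hℓ : 0 < ℓ) {α β t : ℝ} (hα : α ∈ Ico 0 Real.pi)
    (hβ : β ∈ Ioc 0 Real.pi) {q : Potential ℓ} :
    t ∈ eigenvalues ℓ α β q ↔
      ∃ k : ℕ, prueferAngle ℓ α (q - t • onePot ℓ) = β + k * Real.pi := by
  rw [mem_eigenvalues_iff hℓ]
  obtain ⟨r, hr, hb⟩ := exists_bdry_eq hℓ.le α β (q - t • onePot ℓ)
  rw [hb, mul_eq_zero, or_iff_right hr.ne', Real.sin_eq_zero_iff]
  constructor
  · rintro ⟨k, hk⟩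
    have hpos := prueferAngle_pos hℓ hα q t
    -- The angle is positive and `β ≤ π`, so that `k > -1`.
    have h1 : (-1 : ℝ) < k := by
      by_contra! hcon
      have := mul_le_mul_of_nonneg_right hcon Real.pi_pos.le
      linarith [hβ.2]
    have h2 : 0 ≤ k := by
      have : (-1 : ℤ) < k := by exact_mod_cast h1
      omega
    lift k to ℕ using h2
    exact ⟨k, by push_cast at hk; linarith⟩
  · rintro ⟨k, hk⟩
    exact ⟨k, by rw [hk]; push_cast; ring⟩

lemma exists_prueferAngle_eq (hℓ : 0 < ℓ) {α β : ℝ} (hα : α ∈ Ico 0 Real.pi)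
    (hβ : β ∈ Ioc 0 Real.pi) (q : Potential ℓ) (k : ℕ) :
    ∃ t : ℝ, prueferAngle ℓ α (q - t • onePot ℓ) = β + k * Real.pi := by
  have hcont : Continuous fun t : ℝ => prueferAngle ℓ α (q - t • onePot ℓ) :=
    (continuous_prueferAngle hℓ.le α).comp (continuous_sub_smul_onePot q)
  obtain ⟨t₀, h0⟩ := exists_forall_prueferAngle_mem hℓ hα hβ q
  obtain ⟨t₁, h1⟩ := exists_lt_prueferAngle hℓ hα q (β + k * Real.pi)
  refine mem_range_of_exists_le_of_exists_ge hcont ⟨t₀, ?_⟩ ⟨t₁, h1.le⟩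
  have := (h0 t₀ le_rfl).2
  have h2 : 0 ≤ k * Real.pi := by positivity
  linarith

/-- The eigenvalues are the solutions of `angle = β + k π` with `k ∈ ℕ`, one for each `k`, and they
increase with `k` because the angle increases with the spectral parameter. -/
lemma isNthEigenvalue_iff (hℓ : 0 < ℓ) {α β t : ℝ} (hα : α ∈ Ico 0 Real.pi)
    (hβ : β ∈ Ioc 0 Real.pi) {q : Potential ℓ} {n : ℕ} :
    IsNthEigenvalue ℓ α β n q t ↔ prueferAngle ℓ α (q - t • onePot ℓ) = β + n * Real.pi := by
  choose Λ hΛ using exists_prueferAngle_eq hℓ hα hβ q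
  have hmono := strictMono_prueferAngle hℓ α q
  have hpi := Real.pi_pos
  have hlt : ∀ s k, s < Λ k ↔ prueferAngle ℓ α (q - s • onePot ℓ) < β + k * Real.pi := fun s k => by
    rw [← hΛ k]; exact hmono.lt_iff_lt.symm
  have hcard : ∀ k : ℕ, (eigenvalues ℓ α β q ∩ Iio (Λ k)).encard = k := by
    intro k
    have himg : eigenvalues ℓ α β q ∩ Iio (Λ k) = Λ '' (Finset.range k : Set ℕ) := by
      ext s
      simp only [mem_inter_iff, mem_Iio, mem_image, Finset.coe_range]
      constructor
      · rintro ⟨h1, h2⟩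
        obtain ⟨j, hj⟩ := (mem_eigenvalues_iff_angle hℓ hα hβ).1 h1
        rw [hlt, hj] at h2
        refine ⟨j, ?_, hmono.injective ((hΛ j).trans hj.symm)⟩
        have : (j : ℝ) < k := lt_of_mul_lt_mul_right (by linarith) hpi.le
        exact_mod_cast this
      · rintro ⟨j, hj, rfl⟩
        refine ⟨(mem_eigenvalues_iff_angle hℓ hα hβ).2 ⟨j, hΛ j⟩, ?_⟩
        rw [hlt, hΛ]
        have : (j : ℝ) < k := by exact_mod_cast hj
        nlinarith
    have hinj : Function.Injective Λ := by
      intro i j hij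
      have h1 := hΛ i
      rw [hij, hΛ j] at h1
      have : (j : ℝ) = i := mul_right_cancel₀ hpi.ne' (by linarith)
      exact_mod_cast this.symm
    rw [himg, hinj.injOn.encard_image, encard_coe_eq_coe_finsetCard, Finset.card_range]
  constructor
  · rintro ⟨h1, h2⟩
    obtain ⟨j, hj⟩ := (mem_eigenvalues_iff_angle hℓ hα hβ).1 h1
    have hs : t = Λ j := hmono.injective (hj.trans (hΛ j).symm)
    rw [hs, hcard j] at h2
    have : j = n := by exact_mod_cast h2
    rw [hj, this]
  · intro h
    have hs : t = Λ n := hmono.injective (h.trans (hΛ n).symm)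
    refine ⟨(mem_eigenvalues_iff_angle hℓ hα hβ).2 ⟨n, h⟩, ?_⟩
    rw [hs, hcard n]

lemma isNthEigenvalue_eigenvalue (hℓ : 0 < ℓ) {α β : ℝ} (hα : α ∈ Ico 0 Real.pi)
    (hβ : β ∈ Ioc 0 Real.pi) (n : ℕ) (q : Potential ℓ) :
    IsNthEigenvalue ℓ α β n q (eigenvalue ℓ α β n q) := by
  have hex : ∃ t, IsNthEigenvalue ℓ α β n q t :=
    (exists_prueferAngle_eq hℓ hα hβ q n).imp fun _ ht => (isNthEigenvalue_iff hℓ hα hβ).2 ht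
  rw [eigenvalue, dif_pos hex]
  exact hex.choose_spec

lemma prueferAngle_eigenvalue (hℓ : 0 < ℓ) {α β : ℝ} (hα : α ∈ Ico 0 Real.pi)
    (hβ : β ∈ Ioc 0 Real.pi) (n : ℕ) (q : Potential ℓ) :
    prueferAngle ℓ α (q - eigenvalue ℓ α β n q • onePot ℓ) = β + n * Real.pi :=
  (isNthEigenvalue_iff hℓ hα hβ).1 (isNthEigenvalue_eigenvalue hℓ hα hβ n q)

lemma bdry_eigenvalue (hℓ : 0 < ℓ) {α β : ℝ} (hα : α ∈ Ico 0 Real.pi)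
    (hβ : β ∈ Ioc 0 Real.pi) (n : ℕ) (q : Potential ℓ) :
    bdry ℓ α β (q - eigenvalue ℓ α β n q • onePot ℓ) = 0 :=
  (mem_eigenvalues_iff hℓ).1 (isNthEigenvalue_eigenvalue hℓ hα hβ n q).1

/-! ### Smoothness of the eigenvalue -/

/-- By monotonicity of the angle in the spectral parameter, `t < λ_n(q)` and `λ_n(q) < t` are open
conditions on the angle of `q - t`. -/
lemma continuous_eigenvalue (hℓ : 0 < ℓ) {α β : ℝ} (hα : α ∈ Ico 0 Real.pi)
    (hβ : β ∈ Ioc 0 Real.pi) (n : ℕ) : Continuous (eigenvalue ℓ α β n) := by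
  have hangle := prueferAngle_eigenvalue hℓ hα hβ n
  have hc : ∀ t : ℝ, Continuous fun q : Potential ℓ => prueferAngle ℓ α (q - t • onePot ℓ) :=
    fun t => (continuous_prueferAngle hℓ.le α).comp (by fun_prop)
  have hlt : ∀ q t, t < eigenvalue ℓ α β n q ↔
      prueferAngle ℓ α (q - t • onePot ℓ) < β + n * Real.pi := fun q t => by
    rw [← hangle q]; exact (strictMono_prueferAngle hℓ α q).lt_iff_lt.symm
  have hgt : ∀ q t, eigenvalue ℓ α β n q < t ↔
      β + n * Real.pi < prueferAngle ℓ α (q - t • onePot ℓ) := fun q t => by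
    rw [← hangle q]; exact (strictMono_prueferAngle hℓ α q).lt_iff_lt.symm
  rw [continuous_iff_continuousAt]
  intro q
  rw [ContinuousAt, tendsto_order]
  constructor
  · intro t ht
    rw [hlt] at ht
    filter_upwards [((hc t).tendsto q).eventually_lt_const ht] with q' h
    rwa [hlt]
  · intro t ht
    rw [gt_iff_lt, hgt] at ht
    filter_upwards [((hc t).tendsto q).eventually_const_lt ht] with q' h
    rwa [hgt]

lemma fderiv_bdry_onePot_ne_zero (hℓ : 0 < ℓ) {α β : ℝ} {Q : Potential ℓ}
    (h : bdry ℓ α β Q = 0) : fderiv ℝ (bdry ℓ α β) Q (onePot ℓ) ≠ 0 := by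
  intro h0
  have h1 := fderiv_bdry_of_eq_zero hℓ.le h (onePot ℓ)
  have h2 := weight_onePot_pos hℓ (sin_ne_zero_or_cos_ne_zero α) Q
  rw [h0, mul_zero] at h1
  linarith

lemma isInvertible_of_apply_one_ne_zero (f : ℝ →L[ℝ] ℝ) (h : f 1 ≠ 0) : f.IsInvertible :=
  ⟨ContinuousLinearEquiv.unitsEquivAut ℝ (Units.mk0 _ h), by ext; simp⟩

/-- The implicit function theorem applied to the boundary function; the eigenvalue, which is
continuous, coincides with the implicit function. -/
lemma contDiffAt_eigenvalue (hℓ : 0 < ℓ) {α β : ℝ} (hα : α ∈ Ico 0 Real.pi)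
    (hβ : β ∈ Ioc 0 Real.pi) (n : ℕ) (q : Potential ℓ) :
    ContDiffAt ℝ 2 (eigenvalue ℓ α β n) q := by
  set F : Potential ℓ × ℝ → ℝ := fun v => bdry ℓ α β (v.1 - v.2 • onePot ℓ) with hF
  set u : Potential ℓ × ℝ := (q, eigenvalue ℓ α β n q) with hu
  have hFsmooth : ContDiff ℝ 2 F := by
    have h1 : ContDiff ℝ 2 fun v : Potential ℓ × ℝ => v.1 - v.2 • onePot ℓ :=
      contDiff_fst.sub (contDiff_snd.smul contDiff_const)
    have h2 : ContDiff ℝ 2 (bdry ℓ α β) := contDiff_infty.1 (contDiff_bdry hℓ.le α β) 2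
    exact h2.comp h1
  have hFu : F u = 0 := bdry_eigenvalue hℓ hα hβ n q
  have hder : (fderiv ℝ F u ∘L ContinuousLinearMap.inr ℝ (Potential ℓ) ℝ).IsInvertible := by
    apply isInvertible_of_apply_one_ne_zero
    have h1 : HasFDerivAt (fun v : Potential ℓ × ℝ => v.1 - v.2 • onePot ℓ)
        (ContinuousLinearMap.fst ℝ (Potential ℓ) ℝ -
          (ContinuousLinearMap.snd ℝ (Potential ℓ) ℝ).smulRight (onePot ℓ)) u :=
      hasFDerivAt_fst.sub (hasFDerivAt_snd.smul_const (onePot ℓ))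
    have h2 : HasFDerivAt F _ u := (hasFDerivAt_bdry hℓ.le α β _).comp u h1
    rw [h2.fderiv]
    simpa using fderiv_bdry_onePot_ne_zero hℓ hFu
  have hcd : ContDiffAt ℝ 2 F u := hFsmooth.contDiffAt
  have hev := hcd.eventually_apply_eq_iff_implicitFunction (by norm_num) hder
  have hcont : Tendsto (fun q' => (q', eigenvalue ℓ α β n q')) (𝓝 q) (𝓝 u) :=
    (continuous_id.prodMk (continuous_eigenvalue hℓ hα hβ n)).tendsto q
  refine (hcd.contDiffAt_implicitFunction (by norm_num) hder).congr_of_eventuallyEq ?_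
  filter_upwards [hcont.eventually hev] with q' h
  exact (h.1 ((bdry_eigenvalue hℓ hα hβ n q').trans hFu.symm)).symm

lemma hasFDerivAt_eigenvalue (hℓ : 0 < ℓ) {α β : ℝ} (hα : α ∈ Ico 0 Real.pi)
    (hβ : β ∈ Ioc 0 Real.pi) (n : ℕ) (q : Potential ℓ) :
    HasFDerivAt (eigenvalue ℓ α β n) (fderiv ℝ (eigenvalue ℓ α β n) q) q :=
  ((contDiffAt_eigenvalue hℓ hα hβ n q).differentiableAt (by norm_num)).hasFDerivAt

/-! ### First and second derivatives of the eigenvalue -/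

/-- The unnormalized eigenfunction for the `n`-th eigenvalue. -/
abbrev eigenShoot (ℓ α β : ℝ) (n : ℕ) (q : Potential ℓ) : ℝ →ᵇ ℝ :=
  shootZ ℓ α (q - eigenvalue ℓ α β n q • onePot ℓ)

lemma hasFDerivAt_sub_eigenvalue (hℓ : 0 < ℓ) {α β : ℝ} (hα : α ∈ Ico 0 Real.pi)
    (hβ : β ∈ Ioc 0 Real.pi) (n : ℕ) (q : Potential ℓ) :
    HasFDerivAt (fun q : Potential ℓ => q - eigenvalue ℓ α β n q • onePot ℓ)
      (ContinuousLinearMap.id ℝ (Potential ℓ) -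
        (fderiv ℝ (eigenvalue ℓ α β n) q).smulRight (onePot ℓ)) q :=
  (hasFDerivAt_id q).sub ((hasFDerivAt_eigenvalue hℓ hα hβ n q).smul_const (onePot ℓ))

lemma fderiv_eigenvalue (hℓ : 0 < ℓ) {α β : ℝ} (hα : α ∈ Ico 0 Real.pi)
    (hβ : β ∈ Ioc 0 Real.pi) (n : ℕ) (q h : Potential ℓ) :
    fderiv ℝ (eigenvalue ℓ α β n) q h =
      weight ℓ (eigenShoot ℓ α β n q) h / weight ℓ (eigenShoot ℓ α β n q) (onePot ℓ) := by
  have h1 := (hasFDerivAt_bdry hℓ.le α β _).comp q (hasFDerivAt_sub_eigenvalue hℓ hα hβ n q)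
  have h2 : (bdry ℓ α β ∘ fun q => q - eigenvalue ℓ α β n q • onePot ℓ) = fun _ => 0 := by
    funext q'; exact bdry_eigenvalue hℓ hα hβ n q'
  rw [h2] at h1
  have h3 := congrArg (fun T => T h) (h1.unique (hasFDerivAt_const (0 : ℝ) q))
  simp only [ContinuousLinearMap.comp_apply, sub_apply,
    ContinuousLinearMap.id_apply, ContinuousLinearMap.smulRight_apply,
    zero_apply] at h3
  have h4 := fderiv_bdry_of_eq_zero hℓ.le (bdry_eigenvalue hℓ hα hβ n q)
    (h - fderiv ℝ (eigenvalue ℓ α β n) q h • onePot ℓ)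
  rw [h3, mul_zero] at h4
  have hpos := weight_onePot_pos hℓ (sin_ne_zero_or_cos_ne_zero α)
    (q - eigenvalue ℓ α β n q • onePot ℓ)
  rw [eq_div_iff hpos.ne']
  have h5 : weight ℓ (eigenShoot ℓ α β n q) (h - fderiv ℝ (eigenvalue ℓ α β n) q h • onePot ℓ) =
      weight ℓ (eigenShoot ℓ α β n q) h -
        fderiv ℝ (eigenvalue ℓ α β n) q h * weight ℓ (eigenShoot ℓ α β n q) (onePot ℓ) := by
    simp [weight]
  linarith

lemma hasDerivAt_line (q h : Potential ℓ) (s : ℝ) :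
    HasDerivAt (fun s : ℝ => q + s • h) h s := by
  simpa using ((hasDerivAt_id s).smul_const h).const_add q

lemma hasDerivAt_eigenvalue_line (hℓ : 0 < ℓ) {α β : ℝ} (hα : α ∈ Ico 0 Real.pi)
    (hβ : β ∈ Ioc 0 Real.pi) (n : ℕ) (q h : Potential ℓ) (s : ℝ) :
    HasDerivAt (fun s : ℝ => eigenvalue ℓ α β n (q + s • h))
      (fderiv ℝ (eigenvalue ℓ α β n) (q + s • h) h) s :=
  HasFDerivAt.comp_hasDerivAt (l := eigenvalue ℓ α β n) s
    (hasFDerivAt_eigenvalue hℓ hα hβ n (q + s • h)) (hasDerivAt_line q h s)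

lemma secondDeriv_eq_deriv (hℓ : 0 < ℓ) {α β : ℝ} (hα : α ∈ Ico 0 Real.pi)
    (hβ : β ∈ Ioc 0 Real.pi) (n : ℕ) (q h : Potential ℓ) :
    secondDeriv (eigenvalue ℓ α β n) q h =
      deriv (fun s : ℝ => fderiv ℝ (eigenvalue ℓ α β n) (q + s • h) h) 0 := by
  rw [secondDeriv, iteratedDeriv_succ, iteratedDeriv_one]
  congr 1
  funext s
  exact (hasDerivAt_eigenvalue_line hℓ hα hβ n q h s).deriv

lemma iteratedFDeriv_eigenvalue (hℓ : 0 < ℓ) {α β : ℝ} (hα : α ∈ Ico 0 Real.pi)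
    (hβ : β ∈ Ioc 0 Real.pi) (n : ℕ) (q h : Potential ℓ) :
    iteratedFDeriv ℝ 2 (eigenvalue ℓ α β n) q (fun _ => h) =
      secondDeriv (eigenvalue ℓ α β n) q h := by
  rw [iteratedFDeriv_two_apply, secondDeriv_eq_deriv hℓ hα hβ]
  have h1 : DifferentiableAt ℝ (fderiv ℝ (eigenvalue ℓ α β n)) (q + (0 : ℝ) • h) := by
    rw [zero_smul, add_zero]
    exact ((contDiffAt_eigenvalue hℓ hα hβ n q).fderiv_right (m := 1) (by norm_num)).differentiableAt
      (by norm_num)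
  have h2 := h1.hasFDerivAt.comp_hasDerivAt (0 : ℝ) (hasDerivAt_line q h 0)
  have h3 := h2.clm_apply (hasDerivAt_const (0 : ℝ) h)
  have h4 := h3.deriv
  rw [zero_smul, add_zero] at h4
  simp only [Function.comp_apply, map_zero, add_zero] at h4
  exact h4.symm

/-- The second derivative in terms of the unnormalized eigenfunction `z` and of its derivative
`ż` along the direction `k = h - L`. -/
lemma secondDeriv_eigenvalue (hℓ : 0 < ℓ) {α β : ℝ} (hα : α ∈ Ico 0 Real.pi)
    (hβ : β ∈ Ioc 0 Real.pi) (n : ℕ) (q h : Potential ℓ) {L : ℝ}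
    (hL : fderiv ℝ (eigenvalue ℓ α β n) q h = L) :
    secondDeriv (eigenvalue ℓ α β n) q h =
      2 * (volterra ℓ (h - L • onePot ℓ) (eigenShoot ℓ α β n q *
        varZ ℓ (Real.sin α) (Real.cos α) (q - eigenvalue ℓ α β n q • onePot ℓ)
          (h - L • onePot ℓ)) ℓ / weight ℓ (eigenShoot ℓ α β n q) (onePot ℓ)) := by
  set Q : Potential ℓ := q - eigenvalue ℓ α β n q • onePot ℓ with hQ
  set k : Potential ℓ := h - L • onePot ℓ with hk
  set w := varZ ℓ (Real.sin α) (Real.cos α) Q k with hw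
  set z := eigenShoot ℓ α β n q with hz
  have hline : HasDerivAt (fun s : ℝ => q + s • h - eigenvalue ℓ α β n (q + s • h) • onePot ℓ)
      k 0 := by
    have h1 := (hasDerivAt_line q h 0).sub
      ((hasDerivAt_eigenvalue_line hℓ hα hβ n q h 0).smul_const (onePot ℓ))
    rw [zero_smul, add_zero, hL] at h1
    exact h1
  have hbase : q + (0 : ℝ) • h - eigenvalue ℓ α β n (q + (0 : ℝ) • h) • onePot ℓ = Q := by
    rw [zero_smul, add_zero]
  have hzs : HasDerivAt (fun s : ℝ => eigenShoot ℓ α β n (q + s • h)) w 0 := by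
    have h1 := hasFDerivAt_solZ hℓ.le (Real.sin α) (Real.cos α) Q
    rw [← hbase] at h1
    have h2 := h1.comp_hasDerivAt (0 : ℝ) hline
    rw [hbase] at h2
    exact h2
  have hz0 : eigenShoot ℓ α β n (q + (0 : ℝ) • h) = z := by rw [zero_smul, add_zero]
  have hweight : ∀ H : Potential ℓ,
      HasDerivAt (fun s : ℝ => weight ℓ (eigenShoot ℓ α β n (q + s • h)) H)
        (2 * volterra ℓ H (z * w) ℓ) 0 := by
    intro H
    have h1 := hzs.mul hzs
    rw [hz0] at h1
    have h2 := ((BoundedContinuousFunction.evalCLM ℝ ℓ (β := ℝ)).comp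
      (volterra ℓ H)).hasFDerivAt.comp_hasDerivAt (0 : ℝ) h1
    have h3 : ((BoundedContinuousFunction.evalCLM ℝ ℓ (β := ℝ)).comp (volterra ℓ H))
        (w * z + z * w) = 2 * volterra ℓ H (z * w) ℓ := by
      rw [mul_comm w z, ← two_mul, two_mul, map_add, two_mul]; rfl
    rw [h3] at h2
    exact h2
  have hpos := weight_onePot_pos hℓ (sin_ne_zero_or_cos_ne_zero α) Q
  have hdiv := (hweight h).div (hweight (onePot ℓ)) (by rw [hz0]; exact hpos.ne')
  rw [hz0] at hdiv
  rw [secondDeriv_eq_deriv hℓ hα hβ]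
  have hfun : (fun s : ℝ => fderiv ℝ (eigenvalue ℓ α β n) (q + s • h) h) =
      (fun s : ℝ => weight ℓ (eigenShoot ℓ α β n (q + s • h)) h) /
        fun s : ℝ => weight ℓ (eigenShoot ℓ α β n (q + s • h)) (onePot ℓ) := by
    funext s
    exact fderiv_eigenvalue hℓ hα hβ n (q + s • h) h
  rw [hfun, hdiv.deriv]
  have hLw : weight ℓ z h = L * weight ℓ z (onePot ℓ) := by
    rw [← hL, fderiv_eigenvalue hℓ hα hβ, div_mul_cancel₀ _ hpos.ne']
  have hkv : volterra ℓ k (z * w) ℓ =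
      volterra ℓ h (z * w) ℓ - L * volterra ℓ (onePot ℓ) (z * w) ℓ := by
    simp [hk]
  rw [hLw, hkv]
  have hne : weight ℓ z (onePot ℓ) ≠ 0 := hpos.ne'
  field_simp

/-! ### The kernel of the second derivative -/

lemma kernelW_antisymm (ψ₁ ψ₂ : ℝ → ℝ) (x y : ℝ) : kernelW ψ₁ ψ₂ y x = -kernelW ψ₁ ψ₂ x y := by
  simp only [kernelW]; ring

lemma kernelG_symm (ψ₁ ψ₂ : ℝ → ℝ) (x y : ℝ) : kernelG ψ₁ ψ₂ y x = kernelG ψ₁ ψ₂ x y := by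
  have h := kernelW_antisymm ψ₁ ψ₂ x y
  simp only [kernelG]
  rcases lt_trichotomy x y with hxy | rfl | hxy
  · rw [if_neg (not_le.2 hxy), if_pos hxy.le, h, neg_neg]
  · rfl
  · rw [if_pos hxy.le, if_neg (not_le.2 hxy), h]

lemma measurable_kernelW (ψ₁ ψ₂ : ℝ →ᵇ ℝ) :
    Measurable fun p : ℝ × ℝ => kernelW ψ₁ ψ₂ p.1 p.2 := by
  have h1 := ψ₁.continuous.measurable
  have h2 := ψ₂.continuous.measurable
  exact ((h1.comp measurable_fst).mul (h2.comp measurable_snd)).sub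
    ((h2.comp measurable_fst).mul (h1.comp measurable_snd))

lemma abs_kernelW_le (ψ₁ ψ₂ : ℝ →ᵇ ℝ) (x y : ℝ) : |kernelW ψ₁ ψ₂ x y| ≤ 2 * (‖ψ₁‖ * ‖ψ₂‖) := by
  have h1 : |ψ₁ x * ψ₂ y| ≤ ‖ψ₁‖ * ‖ψ₂‖ := by
    rw [abs_mul]
    exact mul_le_mul (ψ₁.norm_coe_le_norm x) (ψ₂.norm_coe_le_norm y) (abs_nonneg _) (norm_nonneg _)
  have h2 : |ψ₂ x * ψ₁ y| ≤ ‖ψ₁‖ * ‖ψ₂‖ := by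
    rw [abs_mul, mul_comm]
    exact mul_le_mul (ψ₁.norm_coe_le_norm y) (ψ₂.norm_coe_le_norm x) (abs_nonneg _) (norm_nonneg _)
  calc _ ≤ |ψ₁ x * ψ₂ y| + |ψ₂ x * ψ₁ y| := abs_sub _ _
    _ ≤ _ := by linarith

lemma measurable_kernelG (ψ₁ ψ₂ : ℝ →ᵇ ℝ) :
    Measurable fun p : ℝ × ℝ => kernelG ψ₁ ψ₂ p.1 p.2 :=
  Measurable.ite (measurableSet_le measurable_fst measurable_snd) (measurable_kernelW ψ₁ ψ₂)
    (measurable_kernelW ψ₁ ψ₂).neg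

lemma abs_kernelG_le (ψ₁ ψ₂ : ℝ →ᵇ ℝ) (x y : ℝ) : |kernelG ψ₁ ψ₂ x y| ≤ 2 * (‖ψ₁‖ * ‖ψ₂‖) := by
  simp only [kernelG]
  split_ifs
  · exact abs_kernelW_le ψ₁ ψ₂ x y
  · rw [abs_neg]; exact abs_kernelW_le ψ₁ ψ₂ x y

lemma integrable_kernelG_mul (ψ₁ ψ₂ : ℝ →ᵇ ℝ) {f g : ℝ → ℝ} (hf : Integrable f (μI ℓ))
    (hg : Integrable g (μI ℓ)) :
    Integrable (fun p : ℝ × ℝ => kernelG ψ₁ ψ₂ p.1 p.2 * (f p.1 * g p.2))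
      ((μI ℓ).prod (μI ℓ)) :=
  (hf.mul_prod hg).bdd_mul (c := 2 * (‖ψ₁‖ * ‖ψ₂‖)) (measurable_kernelG ψ₁ ψ₂).aestronglyMeasurable
    (Eventually.of_forall fun p => abs_kernelG_le ψ₁ ψ₂ p.1 p.2)

/-- The double integral against the symmetric kernel `G` is twice the integral over the triangle
`y ≤ x`. -/
lemma integral_kernelG_mul_self (ψ₁ ψ₂ : ℝ →ᵇ ℝ) {f : ℝ → ℝ} (hf : Integrable f (μI ℓ)) :
    ∫ p : ℝ × ℝ, kernelG ψ₁ ψ₂ p.1 p.2 * (f p.1 * f p.2) ∂((μI ℓ).prod (μI ℓ)) =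
      2 * ∫ x, f x * (∫ y in (0 : ℝ)..x, -(kernelW ψ₁ ψ₂ x y * f y)) ∂(μI ℓ) := by
  set T : ℝ × ℝ → ℝ := fun p =>
    ({p : ℝ × ℝ | p.2 ≤ p.1}.indicator fun p => -kernelW ψ₁ ψ₂ p.1 p.2 * (f p.1 * f p.2)) p with hT
  have hTi : Integrable T ((μI ℓ).prod (μI ℓ)) := by
    refine Integrable.indicator ?_ (measurableSet_le measurable_snd measurable_fst)
    refine (hf.mul_prod hf).bdd_mul (c := 2 * (‖ψ₁‖ * ‖ψ₂‖))
      (measurable_kernelW ψ₁ ψ₂).neg.aestronglyMeasurable (Eventually.of_forall fun p => ?_)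
    rw [norm_neg]; exact abs_kernelW_le ψ₁ ψ₂ p.1 p.2
  have hTs : Integrable (fun p => T p.swap) ((μI ℓ).prod (μI ℓ)) := hTi.swap
  have hsplit : ∀ p : ℝ × ℝ, kernelG ψ₁ ψ₂ p.1 p.2 * (f p.1 * f p.2) = T p + T p.swap := by
    rintro ⟨x, y⟩
    have h := kernelW_antisymm ψ₁ ψ₂ x y
    simp only [hT, kernelG, Prod.swap, indicator, mem_ofPred_eq]
    rcases lt_trichotomy x y with hxy | rfl | hxy
    · rw [if_pos hxy.le, if_neg (not_le.2 hxy), if_pos hxy.le, h]; ring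
    · simp only [le_refl, if_true]
      have h0 : kernelW ψ₁ ψ₂ x x = 0 := by linarith
      rw [h0]; ring
    · rw [if_neg (not_le.2 hxy), if_pos hxy.le, if_neg (not_le.2 hxy)]; ring
  rw [integral_congr_ae (Eventually.of_forall hsplit), integral_add hTi hTs,
    integral_prod_swap T, ← two_mul, integral_prod T hTi]
  refine congrArg (2 * ·) (integral_congr_ae ?_)
  filter_upwards [ae_muI_mem_Ioo (ℓ := ℓ)] with x hx
  have h1 : (fun y => T (x, y)) =
      (Iic x).indicator fun y => f x * -(kernelW ψ₁ ψ₂ x y * f y) := by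
    funext y
    simp only [hT, indicator, mem_ofPred_eq, mem_Iic]
    split_ifs
    · ring
    · rfl
  rw [h1, integral_indicator measurableSet_Iic, integral_const_mul,
    setIntegral_Iic_eq ⟨hx.1.le, hx.2.le⟩]

/-- `x ↦ ∫ G(x, v) E(v) dv`. -/
def kernelGInt (ℓ : ℝ) (ψ₁ ψ₂ E : ℝ → ℝ) (x : ℝ) : ℝ := ∫ v, kernelG ψ₁ ψ₂ x v * E v ∂(μI ℓ)

/-- `∫∫ G(u, v) E(u) E(v) du dv`. -/
def kernelGInt₂ (ℓ : ℝ) (ψ₁ ψ₂ E : ℝ → ℝ) : ℝ :=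
  ∫ p : ℝ × ℝ, kernelG ψ₁ ψ₂ p.1 p.2 * (E p.1 * E p.2) ∂((μI ℓ).prod (μI ℓ))

lemma integrable_bcf (z : ℝ →ᵇ ℝ) : Integrable z (μI ℓ) := z.continuous.integrableOn_Icc

lemma integral_sub_sub_add {X : Type*} [MeasurableSpace X] {μ : Measure X} {a b c d : X → ℝ}
    (ha : Integrable a μ) (hb : Integrable b μ) (hc : Integrable c μ) (hd : Integrable d μ) :
    ∫ x, (a x - b x - c x + d x) ∂μ = ∫ x, a x ∂μ - ∫ x, b x ∂μ - ∫ x, c x ∂μ + ∫ x, d x ∂μ := by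
  have hab : Integrable (fun x => a x - b x) μ := ha.sub hb
  have habc : Integrable (fun x => a x - b x - c x) μ := hab.sub hc
  rw [integral_add habc hd, integral_sub hab hc, integral_sub ha hb]

/-- The kernel `J` for normalized `E`: the integrations over `u` and `v` project the kernel `G` onto
the complement of `E` in both variables. -/
lemma kernelJ_eq (ψ₁ ψ₂ E : ℝ →ᵇ ℝ) (hE : ∫ x, E x * E x ∂(μI ℓ) = 1) (x y : ℝ) :
    kernelJ ℓ ψ₁ ψ₂ E x y =
      (kernelG ψ₁ ψ₂ x y - E y * kernelGInt ℓ ψ₁ ψ₂ E x - E x * kernelGInt ℓ ψ₁ ψ₂ E y +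
        E x * E y * kernelGInt₂ ℓ ψ₁ ψ₂ E) * E x * E y := by
  have hE2 : Integrable (fun t => E t * E t) (μI ℓ) := integrable_bcf (E * E)
  have hG : ∀ x, Integrable (fun v => kernelG ψ₁ ψ₂ x v * E v) (μI ℓ) := fun x =>
    (integrable_bcf E).bdd_mul (c := 2 * (‖ψ₁‖ * ‖ψ₂‖))
      ((measurable_kernelG ψ₁ ψ₂).comp measurable_prodMk_left).aestronglyMeasurable
      (Eventually.of_forall fun v => abs_kernelG_le ψ₁ ψ₂ x v)
  have h1 := (hE2.mul_prod hE2).const_mul (kernelG ψ₁ ψ₂ x y)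
  have h2 := (hE2.mul_prod (hG x)).const_mul (E y)
  have h3 := ((hG y).mul_prod hE2).const_mul (E x)
  have h4 := (integrable_kernelG_mul ψ₁ ψ₂ (integrable_bcf (ℓ := ℓ) E)
    (integrable_bcf E)).const_mul (E x * E y)
  rw [kernelJ]
  congr 2
  have hpt : ∀ p : ℝ × ℝ, kernelJ4 ψ₁ ψ₂ E x y p.1 p.2 * E p.1 * E p.2 =
      kernelG ψ₁ ψ₂ x y * ((E p.1 * E p.1) * (E p.2 * E p.2)) -
        E y * ((E p.1 * E p.1) * (kernelG ψ₁ ψ₂ x p.2 * E p.2)) -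
        E x * ((kernelG ψ₁ ψ₂ y p.1 * E p.1) * (E p.2 * E p.2)) +
        E x * E y * (kernelG ψ₁ ψ₂ p.1 p.2 * (E p.1 * E p.2)) := by
    intro p
    rw [kernelJ4, kernelG_symm ψ₁ ψ₂ y p.1]; ring
  rw [integral_congr_ae (Eventually.of_forall hpt), integral_sub_sub_add h1 h2 h3 h4,
    integral_const_mul, integral_const_mul, integral_const_mul, integral_const_mul,
    integral_prod_mul (fun t => E t * E t) (fun t => E t * E t),
    integral_prod_mul (fun t => E t * E t) (fun t => kernelG ψ₁ ψ₂ x t * E t),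
    integral_prod_mul (fun t => kernelG ψ₁ ψ₂ y t * E t) (fun t => E t * E t), hE]
  simp only [kernelGInt, kernelGInt₂]
  ring

/-- Expanding `h - L = h - ∫ E² h` in the double integral of `G E (h - L) ⊗ E (h - L)` moves the
projection from `h` to the kernel. -/
lemma integral_kernelJ (ψ₁ ψ₂ E : ℝ →ᵇ ℝ) (hE : ∫ x, E x * E x ∂(μI ℓ) = 1) {h : ℝ → ℝ}
    (hh : Integrable h (μI ℓ)) {L : ℝ} (hL : L = ∫ x, E x ^ 2 * h x ∂(μI ℓ)) :
    Integrable (fun p : ℝ × ℝ => kernelJ ℓ ψ₁ ψ₂ E p.1 p.2 * h p.1 * h p.2)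
        ((μI ℓ).prod (μI ℓ)) ∧
      ∫ p : ℝ × ℝ, kernelJ ℓ ψ₁ ψ₂ E p.1 p.2 * h p.1 * h p.2 ∂((μI ℓ).prod (μI ℓ)) =
        ∫ p : ℝ × ℝ, kernelG ψ₁ ψ₂ p.1 p.2 * ((E p.1 * (h p.1 - L)) * (E p.2 * (h p.2 - L)))
          ∂((μI ℓ).prod (μI ℓ)) := by
  have hEi := integrable_bcf (ℓ := ℓ) E
  have hEh : Integrable (fun x => E x * h x) (μI ℓ) :=
    (integrable_mul_bcf hh E).congr (Eventually.of_forall fun x => mul_comm _ _)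
  have hEEh : Integrable (fun x => E x ^ 2 * h x) (μI ℓ) :=
    (integrable_mul_bcf hh (E * E)).congr (Eventually.of_forall fun x => by
      simp only [BoundedContinuousFunction.mul_apply]; ring)
  have i1 := integrable_kernelG_mul ψ₁ ψ₂ hEh hEh
  have i2 := integrable_kernelG_mul ψ₁ ψ₂ hEh hEi
  have i3 := integrable_kernelG_mul ψ₁ ψ₂ hEi hEh
  have i4 := integrable_kernelG_mul ψ₁ ψ₂ hEi hEi
  set g := kernelGInt ℓ ψ₁ ψ₂ E with hg
  set γ := kernelGInt₂ ℓ ψ₁ ψ₂ E with hγ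
  have hfib : ∀ x, ∫ y, kernelG ψ₁ ψ₂ x y * (E x * h x * E y) ∂(μI ℓ) = g x * (E x * h x) := by
    intro x
    rw [hg, kernelGInt, ← integral_mul_const]
    refine integral_congr_ae (Eventually.of_forall fun y => ?_)
    ring
  have hgi : Integrable (fun x => g x * (E x * h x)) (μI ℓ) :=
    i2.integral_prod_left.congr (Eventually.of_forall hfib)
  have hm : ∫ p : ℝ × ℝ, kernelG ψ₁ ψ₂ p.1 p.2 * (E p.1 * h p.1 * E p.2) ∂((μI ℓ).prod (μI ℓ)) =
      ∫ x, g x * (E x * h x) ∂(μI ℓ) := by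
    rw [integral_prod _ i2]
    exact integral_congr_ae (Eventually.of_forall hfib)
  have hm' : ∫ p : ℝ × ℝ, kernelG ψ₁ ψ₂ p.1 p.2 * (E p.1 * (E p.2 * h p.2))
      ∂((μI ℓ).prod (μI ℓ)) = ∫ x, g x * (E x * h x) ∂(μI ℓ) := by
    rw [← hm, ← integral_prod_swap]
    refine integral_congr_ae (Eventually.of_forall fun p => ?_)
    simp only [Prod.fst_swap, Prod.snd_swap]
    rw [kernelG_symm ψ₁ ψ₂ p.1 p.2]; ring
  have j2 := hgi.mul_prod hEEh
  have j3 := hEEh.mul_prod hgi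
  have j4 := (hEEh.mul_prod hEEh).const_mul γ
  have hpt : ∀ p : ℝ × ℝ, kernelG ψ₁ ψ₂ p.1 p.2 * (E p.1 * h p.1 * (E p.2 * h p.2)) -
      g p.1 * (E p.1 * h p.1) * (E p.2 ^ 2 * h p.2) -
      E p.1 ^ 2 * h p.1 * (g p.2 * (E p.2 * h p.2)) +
      γ * (E p.1 ^ 2 * h p.1 * (E p.2 ^ 2 * h p.2)) =
      kernelJ ℓ ψ₁ ψ₂ E p.1 p.2 * h p.1 * h p.2 := by
    intro p
    rw [kernelJ_eq ψ₁ ψ₂ E hE]; ring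
  have hpt' : ∀ p : ℝ × ℝ,
      kernelG ψ₁ ψ₂ p.1 p.2 * ((E p.1 * (h p.1 - L)) * (E p.2 * (h p.2 - L))) =
      kernelG ψ₁ ψ₂ p.1 p.2 * (E p.1 * h p.1 * (E p.2 * h p.2)) -
      L * (kernelG ψ₁ ψ₂ p.1 p.2 * (E p.1 * h p.1 * E p.2)) -
      L * (kernelG ψ₁ ψ₂ p.1 p.2 * (E p.1 * (E p.2 * h p.2))) +
      L ^ 2 * (kernelG ψ₁ ψ₂ p.1 p.2 * (E p.1 * E p.2)) := fun p => by ring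
  refine ⟨(((i1.sub j2).sub j3).add j4).congr (Eventually.of_forall hpt), ?_⟩
  rw [← integral_congr_ae (Eventually.of_forall hpt), integral_congr_ae (Eventually.of_forall hpt'),
    integral_sub_sub_add i1 j2 j3 j4,
    integral_const_mul, integral_prod_mul (fun x => g x * (E x * h x)) (fun x => E x ^ 2 * h x),
    integral_prod_mul (fun x => E x ^ 2 * h x) (fun x => g x * (E x * h x)),
    integral_prod_mul (fun x => E x ^ 2 * h x) (fun x => E x ^ 2 * h x), ← hL,
    integral_sub_sub_add i1 (i2.const_mul L) (i3.const_mul L) (i4.const_mul (L ^ 2)),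
    integral_const_mul, integral_const_mul, integral_const_mul, hm, hm', hγ, kernelGInt₂]
  ring

/-! ### The normalized eigenfunction -/

lemma exists_shoot_pos_near_zero (hℓ : 0 < ℓ) {α : ℝ} (hα : α ∈ Ico 0 Real.pi) (Q : Potential ℓ) :
    ∃ δ > 0, ∀ x ∈ Ioo 0 δ, 0 < shootZ ℓ α Q x := by
  have hev : ∀ᶠ x in 𝓝[>] (0 : ℝ), 0 < shootZ ℓ α Q x := by
    rcases hα.1.eq_or_lt with h | h
    · -- For `α = 0` the solution vanishes at `0` with derivative one.
      have h1 := (isSolPair_sol hℓ.le (Real.sin α) (Real.cos α) Q).hasDerivWithinAt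
        (left_mem_Icc.2 hℓ.le)
      rw [hasDerivWithinAt_iff_tendsto_slope, Icc_sdiff_left, nhdsWithin_Ioc_eq_nhdsGT hℓ,
        solP_zero hℓ.le, ← h, Real.cos_zero] at h1
      filter_upwards [h1.eventually_const_lt one_pos, self_mem_nhdsWithin] with x hx hx0
      rw [slope_def_field, solZ_zero hℓ.le, Real.sin_zero, sub_zero, sub_zero] at hx
      rw [← h]
      change 0 < solZ ℓ (Real.sin 0) (Real.cos 0) Q x
      rw [Real.sin_zero, Real.cos_zero]
      exact (div_pos_iff_of_pos_right hx0).1 hx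
    · have h1 : Tendsto (shootZ ℓ α Q) (𝓝 0) (𝓝 (Real.sin α)) := by
        have := (shootZ ℓ α Q).continuous.tendsto 0
        rwa [solZ_zero hℓ.le] at this
      exact (h1.eventually_const_lt (Real.sin_pos_of_pos_of_lt_pi h hα.2)).filter_mono
        nhdsWithin_le_nhds
  obtain ⟨δ, hδ, hsub⟩ := mem_nhdsGT_iff_exists_Ioo_subset.1 hev
  exact ⟨δ, hδ, fun x hx => hsub hx⟩

/-- The eigenfunction with `L²` norm one that is positive near `0`. -/
def eigenE (ℓ α β : ℝ) (n : ℕ) (q : Potential ℓ) : ℝ →ᵇ ℝ :=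
  (Real.sqrt (weight ℓ (eigenShoot ℓ α β n q) (onePot ℓ)))⁻¹ • eigenShoot ℓ α β n q

lemma isUniqueOn_eigenE (hℓ : 0 < ℓ) {α β : ℝ} (hα : α ∈ Ico 0 Real.pi)
    (hβ : β ∈ Ioc 0 Real.pi) (n : ℕ) (q : Potential ℓ) :
    IsUniqueOn ℓ (IsNormalizedEigenfunction ℓ α β q (eigenvalue ℓ α β n q)) (eigenE ℓ α β n q) := by
  have hpos := weight_onePot_pos hℓ (sin_ne_zero_or_cos_ne_zero α)
    (q - eigenvalue ℓ α β n q • onePot ℓ)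
  set z := eigenShoot ℓ α β n q with hz
  set N := weight ℓ z (onePot ℓ) with hN
  have hNpos : 0 < N := hpos
  have hs := Real.sqrt_pos.2 hNpos
  have hint : ∀ c : ℝ, ∫ x, (c * z x) ^ 2 ∂(μI ℓ) = c ^ 2 * N := by
    intro c
    rw [hN, weight_onePot, ← integral_const_mul]
    refine integral_congr_ae (Eventually.of_forall fun x => ?_)
    ring
  obtain ⟨δ, hδ, hzδ⟩ := exists_shoot_pos_near_zero hℓ hα (q - eigenvalue ℓ α β n q • onePot ℓ)
  have hE : (eigenE ℓ α β n q : ℝ → ℝ) = fun x => (Real.sqrt N)⁻¹ * z x := by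
    funext x; rfl
  rw [hE]
  refine ⟨⟨solvesBVP_const_mul_shoot hℓ (bdry_eigenvalue hℓ hα hβ n q) _, ?_, δ, hδ, fun x hx =>
    mul_pos (inv_pos.2 hs) (hzδ x hx)⟩, ?_⟩
  · rw [hint, inv_pow, Real.sq_sqrt hNpos.le, inv_mul_cancel₀ hNpos.ne', Real.sqrt_one]
  · rintro w ⟨hw, hnorm, δ', hδ', hwδ⟩
    obtain ⟨c, hc, -⟩ := hw.eqOn_shoot hℓ
    have h1 : ∫ x, w x ^ 2 ∂(μI ℓ) = c ^ 2 * N := by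
      rw [← hint]
      refine setIntegral_congr_fun measurableSet_Icc fun x hx => ?_
      simp only [hc hx]; rfl
    have hc2 : c ^ 2 * N = 1 := by
      rw [h1, Real.sqrt_eq_one] at hnorm; exact hnorm
    have hcpos : 0 < c := by
      set x := min (min δ δ') ℓ / 2 with hx
      have hm : 0 < min (min δ δ') ℓ := lt_min (lt_min hδ hδ') hℓ
      have hx0 : 0 < x := half_pos hm
      have hxm : x < min (min δ δ') ℓ := half_lt_self hm
      have e1 : x < δ := hxm.trans_le ((min_le_left _ _).trans (min_le_left _ _))
      have e2 : x < δ' := hxm.trans_le ((min_le_left _ _).trans (min_le_right _ _))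
      have e3 : x ≤ ℓ := (hxm.trans_le (min_le_right _ _)).le
      have h2 := hwδ x ⟨hx0, e2⟩
      rw [hc ⟨hx0.le, e3⟩] at h2
      exact (mul_pos_iff_of_pos_right (hzδ x ⟨hx0, e1⟩)).1 h2
    have hceq : c = (Real.sqrt N)⁻¹ := by
      refine eq_inv_of_mul_eq_one_left ?_
      have h3 : (c * Real.sqrt N) ^ 2 = 1 := by rw [mul_pow, Real.sq_sqrt hNpos.le, hc2]
      exact (pow_eq_one_iff_of_nonneg (mul_pos hcpos hs).le two_ne_zero).1 h3
    intro x hx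
    rw [hc hx, hceq]

end SturmLiouville

end

theorem theorem1p1 (ℓ α β : ℝ) (hℓ : 0 < ℓ) (hα : α ∈ Set.Ico 0 Real.pi)
    (hβ : β ∈ Set.Ioc 0 Real.pi) (n : ℕ) (q h : SturmLiouville.Potential ℓ) :
    -- the `n`-th eigenvalue exists and is twice Fréchet differentiable in the potential
    SturmLiouville.IsNthEigenvalue ℓ α β n q (SturmLiouville.eigenvalue ℓ α β n q) ∧
    ContDiffAt ℝ 2 (SturmLiouville.eigenvalue ℓ α β n) q ∧
    -- the normalized eigenfunction and the fundamental solutions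
    ∃ E ψ₁ ψ₂ : ℝ → ℝ,
      SturmLiouville.IsUniqueOn ℓ
        (SturmLiouville.IsNormalizedEigenfunction ℓ α β q
          (SturmLiouville.eigenvalue ℓ α β n q)) E ∧
      SturmLiouville.IsUniqueOn ℓ
        (SturmLiouville.IsIVPSolution ℓ (fun x => q x - SturmLiouville.eigenvalue ℓ α β n q)
          (fun _ => 0) 1 0) ψ₁ ∧
      SturmLiouville.IsUniqueOn ℓ
        (SturmLiouville.IsIVPSolution ℓ (fun x => q x - SturmLiouville.eigenvalue ℓ α β n q)
          (fun _ => 0) 0 1) ψ₂ ∧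
      -- the first derivative `L` in the direction `h`
      ∃ L : ℝ,
        fderiv ℝ (SturmLiouville.eigenvalue ℓ α β n) q h = L ∧
        HasDerivAt (fun s : ℝ => SturmLiouville.eigenvalue ℓ α β n (q + s • h)) L 0 ∧
        MeasureTheory.Integrable (fun x => E x ^ 2 * h x) (SturmLiouville.μI ℓ) ∧
        L = ∫ x, E x ^ 2 * h x ∂(SturmLiouville.μI ℓ) ∧
        -- the solution `U` of the inhomogeneous initial value problem, and its explicit form
        ∃ U : ℝ → ℝ,
          SturmLiouville.IsUniqueOn ℓ
            (SturmLiouville.IsIVPSolution ℓ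
              (fun x => q x - SturmLiouville.eigenvalue ℓ α β n q)
              (fun x => -(E x * (h x - L))) 0 0) U ∧
          (∀ x ∈ Set.Icc 0 ℓ,
            U x = ∫ y in (0 : ℝ)..x, SturmLiouville.kernelW ψ₁ ψ₂ x y * E y * (L - h y)) ∧
          -- the second derivative, as a directional derivative and as a Fréchet derivative
          iteratedFDeriv ℝ 2 (SturmLiouville.eigenvalue ℓ α β n) q (fun _ => h) =
            SturmLiouville.secondDeriv (SturmLiouville.eigenvalue ℓ α β n) q h ∧
          MeasureTheory.Integrable (fun x => E x * (h x - L) * U x) (SturmLiouville.μI ℓ) ∧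
          SturmLiouville.secondDeriv (SturmLiouville.eigenvalue ℓ α β n) q h =
            2 * ∫ x, E x * (h x - L) * U x ∂(SturmLiouville.μI ℓ) ∧
          -- the second derivative as a quadratic form of `h`
          MeasureTheory.Integrable
            (fun p : ℝ × ℝ => SturmLiouville.kernelJ ℓ ψ₁ ψ₂ E p.1 p.2 * h p.1 * h p.2)
            ((SturmLiouville.μI ℓ).prod (SturmLiouville.μI ℓ)) ∧
          SturmLiouville.secondDeriv (SturmLiouville.eigenvalue ℓ α β n) q h =
            ∫ p : ℝ × ℝ, SturmLiouville.kernelJ ℓ ψ₁ ψ₂ E p.1 p.2 * h p.1 * h p.2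
              ∂((SturmLiouville.μI ℓ).prod (SturmLiouville.μI ℓ)) := by
  open SturmLiouville in
  set Q : Potential ℓ := q - eigenvalue ℓ α β n q • onePot ℓ with hQ
  set L := fderiv ℝ (eigenvalue ℓ α β n) q h with hL
  set k : Potential ℓ := h - L • onePot ℓ with hk
  have hpos := weight_onePot_pos hℓ (sin_ne_zero_or_cos_ne_zero α) Q
  set z := eigenShoot ℓ α β n q with hz
  set N := weight ℓ z (onePot ℓ) with hN
  have hNpos : 0 < N := hpos
  -- The normalizing factor, `E = c z`.
  set c := (Real.sqrt N)⁻¹ with hc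
  have hc2 : c * c = N⁻¹ := by
    rw [hc, ← mul_inv, Real.mul_self_sqrt hNpos.le]
  set E := eigenE ℓ α β n q with hE
  have hEz : ∀ x, E x = c * z x := fun x => rfl
  set w := varZ ℓ (Real.sin α) (Real.cos α) Q k with hw
  have hkx := coeFn_sub_smul_onePot h L
  have hLint : L = ∫ x, E x ^ 2 * h x ∂(μI ℓ) := by
    rw [hL, fderiv_eigenvalue hℓ hα hβ, ← hz, ← hN, div_eq_inv_mul, ← hc2, weight_eq,
      ← integral_const_mul]
    refine integral_congr_ae (Filter.Eventually.of_forall fun x => ?_)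
    simp only [hEz]; ring
  have hEE : ∫ x, E x * E x ∂(μI ℓ) = 1 := by
    rw [← mul_inv_cancel₀ hNpos.ne', ← hc2, mul_comm N, hN, weight_onePot, ← integral_const_mul]
    refine integral_congr_ae (Filter.Eventually.of_forall fun x => ?_)
    simp only [hEz]; ring
  have hψ₁ := isSolPair_sol hℓ.le 1 0 Q
  have hψ₂ := isSolPair_sol hℓ.le 0 1 Q
  have hh := integrable_potential h
  have hf : Integrable (fun x => E x * (h x - L)) (μI ℓ) :=
    (integrable_mul_bcf (integrable_potential k) E).congr (by
      filter_upwards [hkx] with x hx; rw [hx, mul_comm])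
  -- `U = c ż`: the linearized equation for `ż` is the one for `U`, up to the normalization of `z`.
  have hU : IsSolPair ℓ Q (fun x => -(E x * (h x - L))) (fun x => c * w x)
      (fun x => c * varP ℓ (Real.sin α) (Real.cos α) Q k x) :=
    ((isSolPair_var hℓ.le (Real.sin α) (Real.cos α) Q k).const_mul c).congr_ae (by
      filter_upwards [hkx] with x hx
      rw [hx, hEz]
      ring)
  have hUint : ∀ x ∈ Set.Icc 0 ℓ, c * w x =
      ∫ y in (0 : ℝ)..x, -(kernelW (solZ ℓ 1 0 Q) (solZ ℓ 0 1 Q) x y * (E y * (h y - L))) := by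
    intro x hx
    rw [hU.eq_integral (by rw [varZ_zero hℓ.le, mul_zero]) (by rw [varP_zero hℓ.le, mul_zero])
      hψ₁ hψ₂ (solZ_zero hℓ.le _ _ _) (solP_zero hℓ.le _ _ _) (solZ_zero hℓ.le _ _ _)
      (solP_zero hℓ.le _ _ _) hx]
    refine intervalIntegral.integral_congr fun y _ => ?_
    ring
  have hsecond : secondDeriv (eigenvalue ℓ α β n) q h =
      2 * ∫ x, E x * (h x - L) * (c * w x) ∂(μI ℓ) := by
    rw [secondDeriv_eigenvalue hℓ hα hβ n q h hL.symm, volterra_apply_right, div_eq_inv_mul,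
      ← hz, ← hN, ← hc2, ← integral_const_mul]
    congr 1
    refine integral_congr_ae ?_
    filter_upwards [hkx] with x hx
    rw [hx, hEz, BoundedContinuousFunction.mul_apply]
    ring
  have hJ := integral_kernelJ (solZ ℓ 1 0 Q) (solZ ℓ 0 1 Q) E hEE hh hLint
  refine ⟨isNthEigenvalue_eigenvalue hℓ hα hβ n q, contDiffAt_eigenvalue hℓ hα hβ n q,
    E, solZ ℓ 1 0 Q, solZ ℓ 0 1 Q, isUniqueOn_eigenE hℓ hα hβ n q,
    isUniqueOn_ivp hℓ q _ hψ₁ (solZ_zero hℓ.le _ _ _) (solP_zero hℓ.le _ _ _),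
    isUniqueOn_ivp hℓ q _ hψ₂ (solZ_zero hℓ.le _ _ _) (solP_zero hℓ.le _ _ _),
    L, rfl, ?_, ?_, hLint, fun x => c * w x,
    isUniqueOn_ivp hℓ q _ hU (by rw [varZ_zero hℓ.le, mul_zero])
      (by rw [varP_zero hℓ.le, mul_zero]),
    ?_, iteratedFDeriv_eigenvalue hℓ hα hβ n q h, integrable_mul_bcf hf (c • w), hsecond,
    hJ.1, ?_⟩
  · have := hasDerivAt_eigenvalue_line hℓ hα hβ n q h 0
    rwa [zero_smul, add_zero] at this
  · refine (integrable_mul_bcf hh (E * E)).congr (Filter.Eventually.of_forall fun x => ?_)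
    simp only [BoundedContinuousFunction.mul_apply]; ring
  · intro x hx
    simp only
    rw [hUint x hx]
    refine intervalIntegral.integral_congr fun y _ => ?_
    ring
  · rw [hJ.2, hsecond, integral_kernelG_mul_self _ _ hf]
    refine congrArg (2 * ·) (setIntegral_congr_fun measurableSet_Icc fun x hx => ?_)
    rw [hUint x hx]
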